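/- Let $\mathcal H,\mathcal K$ be finite dimensional complex Hilbert spaces, let $\mathcal A\subseteq B(\mathcal H)$ and $\mathcal B\subseteq B(\mathcal K)$ be $C^*$-subalgebras containing the identity operators, and let $\mathcal S\subset\mathcal A$ be a set of density operators (positive operators of trace $1$; ${\rm Tr}$ is the trace of $B(\mathcal H)$, resp. $B(\mathcal K)$). For a linear map $T$ between such algebras, $T^*$ is its adjoint with respect to the Hilbert–Schmidt inner products $\langle a,b\rangle={\rm Tr}\,a^*b$. A linear map $\Phi$ is a unital Schwarz map if $\Phi(I)=I$ and $\Phi(a^*a)\ge\Phi(a)^*\Phi(a)$ for all $a$. A linear map $T:\mathcal A\to\mathcal B$ such that $T^*$ is a unital Schwarz map is called reversible for $\mathcal S$ if there is a linear map $R:\mathcal B\to\mathcal A$ such that $R^*$ is a unital Schwarz map and $R(T(\sigma))=\sigma$ for all $\sigma\in\mathcal S$. Let $\|a\|_1={\rm Tr}\,(a^*a)^{1/2}$. Let $T:\mathcal A\to\mathcal B$ be linear and assume: 1. $\mathcal S$ contains an invertible element $\rho$, and $T(\rho)$ is invertible as well; 2. both $T^*$ and $T_\rho$ are unital Schwarz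 maps, where $T_\rho(b)=T(\rho)^{-1/2}\,T(\rho^{1/2}b\rho^{1/2})\,T(\rho)^{-1/2}$ for $b\in\mathcal A$. Let $\tilde{\mathcal S}=\bigcup_{s\in\mathbb R}\rho^{is}\mathcal S\rho^{-is}$. Then: (i) $T$ is reversible for $\mathcal S$ if and only if $\|\sigma-t\rho\|_1=\|T(\sigma)-tT(\rho)\|_1$ for all $\sigma\in\tilde{\mathcal S}$ and all $t\ge 0$. (ii) If $\rho^{is}\mathcal S\rho^{-is}\subseteq\mathcal S$ for all $s\in\mathbb R$, then $T$ is reversible for $\mathcal S$ if and only if $$\|\sigma-t\rho\|_1=\|T(\sigma)-tT(\rho)\|_1\quad\text{for all }\sigma\in\mathcal S,\ t\ge 0.\qquad(*)$$ (iii) If $\mathcal B$ is abelian, then $T$ is reversible for $\mathcal S$ if and only if $(*)$ holds. Moreover, if $\mathcal B$ is abelian and $T$ is reversible for $\mathcal S$ (equivalently, $(*)$ holds), then all elements of $\mathcal S$ commute with each other. (iv) If all elements of $\mathcal S$ commute with $\rho$, then $T$ is reversible for $\mathcal S$ if and only if $(*)$ holds. -/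

import Mathlib

noncomputable section

namespace QRev

variable {H K : Type*}
  [NormedAddCommGroup H] [InnerProductSpace ℂ H] [CompleteSpace H] [FiniteDimensional ℂ H]
  [NormedAddCommGroup K] [InnerProductSpace ℂ K] [CompleteSpace K] [FiniteDimensional ℂ K]

/-- A star subalgebra of the operators on a finite dimensional Hilbert space is closed, hence is a
C*-algebra and carries the continuous functional calculus. -/
instance isClosed_starSubalgebra (A : StarSubalgebra ℂ (H →L[ℂ] H)) :
    IsClosed (A : Set (H →L[ℂ] H)) :=
  Submodule.closed_of_finiteDimensional (Subalgebra.toSubmodule A.toSubalgebra)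

instance finiteDimensional_starSubalgebra (A : StarSubalgebra ℂ (H →L[ℂ] H)) :
    FiniteDimensional ℂ A :=
  inferInstanceAs (FiniteDimensional ℂ (Subalgebra.toSubmodule A.toSubalgebra))

/-- The trace `Tr_H` on the operators on `H`. -/
def tr : (H →L[ℂ] H) →ₗ[ℂ] ℂ :=
  LinearMap.trace ℂ H ∘ₗ ContinuousLinearMap.coeLM ℂ

/-- The trace norm `‖a‖₁ = Tr |a|`, where `|a| = (a* a)^{1/2}`. -/
def traceNorm (a : H →L[ℂ] H) : ℝ := (tr (CFC.abs a)).re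

/-- Density operators (identified with states) of the algebra `A`. -/
def IsState {A : StarSubalgebra ℂ (H →L[ℂ] H)} (ρ : A) : Prop :=
  0 ≤ (ρ : H →L[ℂ] H) ∧ tr (ρ : H →L[ℂ] H) = 1

/-- The power `ρ ^ z` of a positive element, with a complex exponent `z`. On the kernel of `ρ` the
value is `0` for `z ≠ 0`, so that negative powers are powers of the generalized inverse. -/
def opPow {A : StarSubalgebra ℂ (H →L[ℂ] H)} (ρ : A) (z : ℂ) : A :=
  cfc (fun w : ℂ => w ^ z) ρ

/-- The linear map `x ↦ (a ↦ Tr (x a))` from `A` to its dual. -/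
def trForm (A : StarSubalgebra ℂ (H →L[ℂ] H)) : A →ₗ[ℂ] Module.Dual ℂ A where
  toFun x := tr ∘ₗ A.subtype.toLinearMap ∘ₗ LinearMap.mulLeft ℂ x
  map_add' x y := by ext a; simp [add_mul]
  map_smul' c x := by ext a; simp

@[simp] lemma trForm_apply (A : StarSubalgebra ℂ (H →L[ℂ] H)) (x a : A) :
    trForm A x a = tr ((x * a : A) : H →L[ℂ] H) := rfl

lemma eq_zero_of_tr_star_mul_self (x : H →L[ℂ] H) (h : tr (star x * x) = 0) : x = 0 := by
  have key : tr (star x * x) =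
      ((∑ i, ‖x (stdOrthonormalBasis ℂ H i)‖ ^ 2 : ℝ) : ℂ) := by
    change LinearMap.trace ℂ H _ = _
    rw [LinearMap.trace_eq_sum_inner _ (stdOrthonormalBasis ℂ H)]
    push_cast
    refine Finset.sum_congr rfl fun i _ => ?_
    change inner ℂ _ ((ContinuousLinearMap.adjoint x) (x _)) = _
    rw [ContinuousLinearMap.adjoint_inner_right, inner_self_eq_norm_sq_to_K]
    rfl
  rw [key] at h
  have h' : ∑ i, ‖x (stdOrthonormalBasis ℂ H i)‖ ^ 2 = 0 := by exact_mod_cast h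
  rw [Finset.sum_eq_zero_iff_of_nonneg (fun i _ => by positivity)] at h'
  apply ContinuousLinearMap.coe_injective
  refine (stdOrthonormalBasis ℂ H).toBasis.ext fun i => ?_
  have := h' i (Finset.mem_univ i)
  simpa using this

lemma trForm_injective (A : StarSubalgebra ℂ (H →L[ℂ] H)) :
    Function.Injective (trForm A) := by
  rw [injective_iff_map_eq_zero]
  intro x hx
  have h : tr (((x * star x : A)) : H →L[ℂ] H) = 0 := by
    rw [← trForm_apply, hx]; rfl
  have := eq_zero_of_tr_star_mul_self (star (x : H →L[ℂ] H)) (by simpa using h)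
  exact Subtype.ext (by simpa using this)

/-- The identification of `A` with its dual through the trace. -/
def trEquiv (A : StarSubalgebra ℂ (H →L[ℂ] H)) : A ≃ₗ[ℂ] Module.Dual ℂ A :=
  (trForm A).linearEquivOfInjective (trForm_injective A) Subspace.dual_finrank_eq.symm

/-- The adjoint `T*` of `T` with respect to the Hilbert-Schmidt inner products
`⟨a, b⟩ = Tr (a* b)` (see `hsAdjoint_spec`). -/
def hsAdjoint {A : StarSubalgebra ℂ (H →L[ℂ] H)} {B : StarSubalgebra ℂ (K →L[ℂ] K)}
    (T : A →ₗ[ℂ] B) : B →ₗ[ℂ] A where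
  toFun b := star ((trEquiv A).symm (trForm B (star b) ∘ₗ T))
  map_add' x y := by simp [LinearMap.add_comp]
  map_smul' c x := by simp [LinearMap.smul_comp]

theorem hsAdjoint_spec {A : StarSubalgebra ℂ (H →L[ℂ] H)} {B : StarSubalgebra ℂ (K →L[ℂ] K)}
    (T : A →ₗ[ℂ] B) (a : A) (b : B) :
    tr ((star (hsAdjoint T b) * a : A) : H →L[ℂ] H) = tr ((star b * T a : B) : K →L[ℂ] K) := by
  have h : trForm A (star (hsAdjoint T b)) = trForm B (star b) ∘ₗ T := by
    change trForm A (star (star ((trEquiv A).symm (trForm B (star b) ∘ₗ T)))) = _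
    rw [star_star]
    exact (trEquiv A).apply_symm_apply (trForm B (star b) ∘ₗ T)
  exact LinearMap.congr_fun h a

/-- Unital Schwarz maps: linear maps with `Φ(I) = I` and `Φ(a)* Φ(a) ≤ Φ(a* a)`. -/
def IsUnitalSchwarz {A : StarSubalgebra ℂ (H →L[ℂ] H)} {B : StarSubalgebra ℂ (K →L[ℂ] K)}
    (Φ : A →ₗ[ℂ] B) : Prop :=
  Φ 1 = 1 ∧ ∀ a : A,
    ((star (Φ a) * Φ a : B) : K →L[ℂ] K) ≤ ((Φ (star a * a) : B) : K →L[ℂ] K)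

/-- The map `T_ρ(b) = T(ρ)^{-1/2} T(ρ^{1/2} b ρ^{1/2}) T(ρ)^{-1/2}`. -/
def dualMap {A : StarSubalgebra ℂ (H →L[ℂ] H)} {B : StarSubalgebra ℂ (K →L[ℂ] K)}
    (T : A →ₗ[ℂ] B) (ρ : A) : A →ₗ[ℂ] B where
  toFun b := opPow (T ρ) (-(1 / 2)) * T (opPow ρ (1 / 2) * b * opPow ρ (1 / 2)) *
    opPow (T ρ) (-(1 / 2))
  map_add' x y := by simp [mul_add, add_mul]
  map_smul' c x := by simp

/-- `T` is reversible for `S`: there is a linear map `R : B → A` such that `R*` is a unital Schwarz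
map and `R (T σ) = σ` for all `σ` in `S`. -/
def IsReversible {A : StarSubalgebra ℂ (H →L[ℂ] H)} {B : StarSubalgebra ℂ (K →L[ℂ] K)}
    (T : A →ₗ[ℂ] B) (S : Set A) : Prop :=
  ∃ R : B →ₗ[ℂ] A, IsUnitalSchwarz (hsAdjoint R) ∧ ∀ σ ∈ S, R (T σ) = σ

/-- `ρ^{is} σ ρ^{-is}`. -/
def modConj {A : StarSubalgebra ℂ (H →L[ℂ] H)} (ρ : A) (s : ℝ) (σ : A) : A :=
  opPow ρ (Complex.I * s) * σ * opPow ρ (-(Complex.I * s))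

/-- The extended family `⋃ₛ ρ^{is} S ρ^{-is}`. -/
def extFamily {A : StarSubalgebra ℂ (H →L[ℂ] H)} (ρ : A) (S : Set A) : Set A :=
  ⋃ s : ℝ, modConj ρ s '' S

/-- `‖σ - tρ‖₁ = ‖T(σ) - tT(ρ)‖₁` for all `σ` in `S` and all `t ≥ 0`. -/
def PreservesTraceNorm {A : StarSubalgebra ℂ (H →L[ℂ] H)} {B : StarSubalgebra ℂ (K →L[ℂ] K)}
    (T : A →ₗ[ℂ] B) (ρ : A) (S : Set A) : Prop :=
  ∀ σ ∈ S, ∀ t : ℝ, 0 ≤ t →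
    traceNorm ((σ - (t : ℂ) • ρ : A) : H →L[ℂ] H) =
      traceNorm ((T σ - (t : ℂ) • T ρ : B) : K →L[ℂ] K)

end QRev

end

set_option linter.unusedSectionVars false

noncomputable section

namespace QRev

open Filter Topology

-- Write `T*` for the Hilbert–Schmidt adjoint. For selfadjoint `X` and positive `Y`, the convex
-- function `e ↦ ‖X + eY‖₁` has a jump of slope `2 Tr(Yp)` at `0`, where `p` is the kernel
-- projection of `X`. If `T` preserves these norms, comparing slopes gives `Tr(Yp) ≤ Tr(Y T*(q))`,
-- where `q` is the kernel projection of `T X`. Equality of norms at `e = 0` gives `T*(q) ≤ p`, so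
-- an invertible `Y` forces `T*(q) = p` (`hsAdjoint_kerProj`). Then `T*(q)` is a projection, the
-- Schwarz inequality is an equality at `q`, and `q` lies in the multiplicative domain of `T*`.
--
-- Sufficiency. Let `k` be the kernel projection of `σ - tρ`. Norm preservation on the extended
-- family puts the whole modular orbit of `k` into the image under `T*` of its multiplicative
-- domain. Independence of characters splits `k` into modular eigenvectors inside this image, and on
-- each of them `T_ρ` inverts `T*`; so `T* T_ρ` fixes `k` (`hsAdjoint_dualMap_eq_self`). Let `R` be
-- the adjoint of `T_ρ` and `L = R T`, so that `L ρ = ρ`. Fixed points of `T* T_ρ` are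
-- multiplicative, whence `L(ak) = L(a)k` and `L(σ)k = tρk = σk`. The kernels of the pencil span the
-- space (`eq_zero_of_pencil`), hence `L(σ) = σ`.
--
-- Necessity. If `R T` fixes `S`, which contains the faithful `ρ`, its fixed points are both `ρF`
-- and `Fρ`, where `F` is the fixed-point space of the adjoint map. They are therefore invariant
-- under the modular group (`modConj_fixed`), and the norms agree because `T` and `R` both contract
-- the trace norm.
--
-- The other parts need only the original family: it is its own extension when invariant, in
-- particular when it commutes with `ρ`. For abelian `B` the kernel projections commute, being
-- images of commuting elements of the multiplicative domain, and this forces the elements of `S` to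
-- commute.

local instance algebraComplexOperators {E : Type*} [NormedAddCommGroup E] [InnerProductSpace ℂ E] :
    Algebra ℂ (E →L[ℂ] E) := inferInstance

local instance algebraRealOperators {E : Type*} [NormedAddCommGroup E] [InnerProductSpace ℂ E] :
    Algebra ℝ (E →L[ℂ] E) := inferInstance

variable {H K L : Type*}
  [NormedAddCommGroup H] [InnerProductSpace ℂ H] [CompleteSpace H] [FiniteDimensional ℂ H]
  [NormedAddCommGroup K] [InnerProductSpace ℂ K] [CompleteSpace K] [FiniteDimensional ℂ K]
  [NormedAddCommGroup L] [InnerProductSpace ℂ L] [CompleteSpace L] [FiniteDimensional ℂ L]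
  {A : StarSubalgebra ℂ (H →L[ℂ] H)} {B : StarSubalgebra ℂ (K →L[ℂ] K)}
  {C : StarSubalgebra ℂ (L →L[ℂ] L)}

/-! ### Shortcut instances for star subalgebras -/

local instance : Ring A := inferInstance
local instance : Semiring A := inferInstance
local instance : NonUnitalNonAssocSemiring A := inferInstance
local instance : NonUnitalRing A := inferInstance
local instance : AddCommGroup A := inferInstance
local instance : AddGroup A := inferInstance
local instance : AddMonoid A := inferInstance
local instance : Monoid A := inferInstance
local instance : Mul A := inferInstance
local instance : StarRing A := inferInstance
local instance : Algebra ℝ A := inferInstance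
local instance : Module ℝ A := Algebra.toModule
local instance : Module ℂ A := inferInstance
local instance : SMulCommClass ℝ A A := inferInstance
local instance : IsScalarTower ℝ A A := inferInstance
local instance : IsTopologicalRing A := inferInstance
local instance : T2Space A := inferInstance
local instance : ContinuousFunctionalCalculus ℝ A IsSelfAdjoint := inferInstance
local instance : NonUnitalContinuousFunctionalCalculus ℝ A IsSelfAdjoint := inferInstance
local instance : ContinuousFunctionalCalculus ℂ A IsStarNormal := inferInstance
local instance : IsScalarTower ℝ ℂ A := inferInstance
local instance : Module.IsTorsionFree ℂ A := inferInstance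

/-! ### The order and the functional calculus of a star subalgebra -/

/-- The spectrum consists of roots of the minimal polynomial. Finiteness makes every function
continuous on it, so the functional calculus applies to jumps such as those in `sgn` and `kerProj`.
-/
lemma finite_spectrum_complex (a : A) : (spectrum ℂ a).Finite := by
  rcases subsingleton_or_nontrivial A with h | h
  · rw [spectrum.of_subsingleton]
    exact Set.finite_empty
  have hp : minpoly ℂ a ≠ 0 := minpoly.ne_zero (Algebra.IsIntegral.isIntegral a)
  refine (minpoly ℂ a).roots.toFinset.finite_toSet.subset fun z hz => ?_
  have h := spectrum.subset_polynomial_aeval a (minpoly ℂ a) ⟨z, hz, rfl⟩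
  rw [minpoly.aeval] at h
  have h0 : (minpoly ℂ a).eval z = 0 := by simpa using h
  simpa [hp] using h0

lemma finite_spectrum_real (a : A) : (spectrum ℝ a).Finite := by
  rw [← spectrum.preimage_algebraMap ℂ]
  exact (finite_spectrum_complex a).preimage (Complex.ofReal_injective.injOn)

lemma continuousOn_spectrum_complex {X : Type*} [TopologicalSpace X] (f : ℂ → X) (a : A) :
    ContinuousOn f (spectrum ℂ a) :=
  (finite_spectrum_complex a).continuousOn f

lemma continuousOn_spectrum_real {X : Type*} [TopologicalSpace X] (f : ℝ → X) (a : A) :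
    ContinuousOn f (spectrum ℝ a) :=
  (finite_spectrum_real a).continuousOn f

/-- Spectral permanence: the spectrum in `A` agrees with that in all operators, so the square root
can be taken inside `A`. -/
lemma exists_star_mul_self_of_nonneg {a : A} (ha : 0 ≤ (a : H →L[ℂ] H)) :
    ∃ c : A, a = star c * c := by
  have hsa : IsSelfAdjoint a := Subtype.ext (by simpa using (IsSelfAdjoint.of_nonneg ha).star_eq)
  have hsp : ∀ x ∈ spectrum ℝ a, 0 ≤ x := by
    intro x hx
    rw [← spectrum.preimage_algebraMap ℂ, Set.mem_preimage, StarSubalgebra.spectrum_eq,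
      ← Set.mem_preimage, spectrum.preimage_algebraMap] at hx
    exact spectrum_nonneg_of_nonneg ha hx
  refine ⟨cfc Real.sqrt a, ?_⟩
  rw [(cfc_predicate Real.sqrt a : IsSelfAdjoint _).star_eq, ← cfc_mul Real.sqrt Real.sqrt a]
  conv_lhs => rw [← cfc_id ℝ a]
  exact cfc_congr fun x hx => (Real.mul_self_sqrt (hsp x hx)).symm

local instance starOrderedRing_starSubalgebra : StarOrderedRing A := by
  refine StarOrderedRing.of_nonneg_iff' (fun {x y} h z => ?_) fun x => ⟨fun h => ?_, ?_⟩
  · exact add_le_add_right (α := H →L[ℂ] H) h z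
  · obtain ⟨c, hc⟩ := exists_star_mul_self_of_nonneg (a := x) h
    exact ⟨c, hc⟩
  · rintro ⟨s, rfl⟩
    exact star_mul_self_nonneg (s : H →L[ℂ] H)

local instance : IsOrderedAddMonoid A := inferInstance
local instance : AddLeftMono A := inferInstance
local instance : AddRightMono A := inferInstance
local instance : NonnegSpectrumClass ℝ A := inferInstance

lemma coe_nonneg {a : A} : 0 ≤ (a : H →L[ℂ] H) ↔ 0 ≤ a := Iff.rfl

lemma coe_cfcAbs (a : A) : ((CFC.abs a : A) : H →L[ℂ] H) = CFC.abs (a : H →L[ℂ] H) := by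
  refine (CFC.sqrt_unique (a := star (a : H →L[ℂ] H) * a) ?_ (CFC.abs_nonneg a)).symm
  have := congrArg (Subtype.val) (CFC.abs_mul_abs a)
  exact this

/-! ### The trace -/

variable (A) in
/-- The trace of `B(H)`, restricted to a subalgebra. -/
def subTr : A →ₗ[ℂ] ℂ := tr ∘ₗ A.subtype.toLinearMap

lemma subTr_apply (a : A) : subTr A a = tr (a : H →L[ℂ] H) := rfl

lemma subTr_mul_comm (a b : A) : subTr A (a * b) = subTr A (b * a) :=
  LinearMap.trace_mul_comm ℂ ((a : H →L[ℂ] H) : H →ₗ[ℂ] H) ((b : H →L[ℂ] H) : H →ₗ[ℂ] H)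

lemma subTr_mul_cycle (a b c : A) : subTr A (a * b * c) = subTr A (c * a * b) := by
  rw [subTr_mul_comm, mul_assoc]

lemma tr_star_mul_self (x : H →L[ℂ] H) : tr (star x * x) =
    ((∑ i, ‖x (stdOrthonormalBasis ℂ H i)‖ ^ 2 : ℝ) : ℂ) := by
  change LinearMap.trace ℂ H _ = _
  rw [LinearMap.trace_eq_sum_inner _ (stdOrthonormalBasis ℂ H)]
  push_cast
  refine Finset.sum_congr rfl fun i _ => ?_
  change inner ℂ _ ((ContinuousLinearMap.adjoint x) (x _)) = _
  rw [ContinuousLinearMap.adjoint_inner_right, inner_self_eq_norm_sq_to_K]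
  rfl

lemma nonneg_iff_exists {a : A} : 0 ≤ a ↔ ∃ c : A, a = star c * c :=
  ⟨fun h => exists_star_mul_self_of_nonneg h, by rintro ⟨c, rfl⟩; exact star_mul_self_nonneg c⟩

lemma subTr_star_mul_self_re_nonneg (c : A) : 0 ≤ (subTr A (star c * c)).re := by
  change 0 ≤ (tr (star (c : H →L[ℂ] H) * (c : H →L[ℂ] H))).re
  rw [tr_star_mul_self, Complex.ofReal_re]
  positivity

lemma eq_zero_of_subTr_star_mul_self {c : A} (h : (subTr A (star c * c)).re = 0) : c = 0 := by
  refine Subtype.ext (eq_zero_of_tr_star_mul_self _ ?_)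
  change (tr (star (c : H →L[ℂ] H) * (c : H →L[ℂ] H))).re = 0 at h
  rw [tr_star_mul_self, Complex.ofReal_re] at h
  rw [tr_star_mul_self, h, Complex.ofReal_zero]

/-- The trace of `c*c d*d` is the squared Hilbert–Schmidt norm of `c d*`. The same identity gives
the equality case below. -/
lemma subTr_mul_re_nonneg {a b : A} (ha : 0 ≤ a) (hb : 0 ≤ b) : 0 ≤ (subTr A (a * b)).re := by
  obtain ⟨c, rfl⟩ := nonneg_iff_exists.1 ha
  obtain ⟨d, rfl⟩ := nonneg_iff_exists.1 hb
  have : subTr A (star c * c * (star d * d)) = subTr A (star (c * star d) * (c * star d)) := by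
    rw [← mul_assoc, subTr_mul_comm]
    simp [mul_assoc]
  rw [this]
  exact subTr_star_mul_self_re_nonneg _

lemma mul_eq_zero_of_subTr_mul {a b : A} (ha : 0 ≤ a) (hb : 0 ≤ b)
    (h : (subTr A (a * b)).re = 0) : a * b = 0 := by
  obtain ⟨c, rfl⟩ := nonneg_iff_exists.1 ha
  obtain ⟨d, rfl⟩ := nonneg_iff_exists.1 hb
  have : subTr A (star c * c * (star d * d)) = subTr A (star (c * star d) * (c * star d)) := by
    rw [← mul_assoc, subTr_mul_comm]
    simp [mul_assoc]
  rw [this] at h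
  have h0 := eq_zero_of_subTr_star_mul_self h
  calc star c * c * (star d * d) = star c * (c * star d) * d := by simp [mul_assoc]
    _ = 0 := by rw [h0]; simp

lemma eq_of_subTr_mul_right {a b : A} (h : ∀ x, subTr A (a * x) = subTr A (b * x)) : a = b :=
  trForm_injective A (LinearMap.ext h)

lemma eq_of_subTr_mul_left {a b : A} (h : ∀ x, subTr A (x * a) = subTr A (x * b)) : a = b :=
  eq_of_subTr_mul_right fun x => by rw [subTr_mul_comm a, subTr_mul_comm b, h]

lemma traceNorm_coe (a : A) : traceNorm (a : H →L[ℂ] H) = (subTr A (CFC.abs a)).re := by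
  rw [traceNorm, subTr_apply, coe_cfcAbs]

/-! ### Trace norm and sign operators -/

/-- Writes the defect of `u` from norming `X` as two terms, nonnegative when `-1 ≤ u ≤ 1`. Hence the
duality bound, and in the equality case both products vanish. -/
lemma subTr_mul_eq_sub {X u : A} (hX : IsSelfAdjoint X) :
    (subTr A (X * u)).re = (subTr A (CFC.abs X)).re -
      ((subTr A (X⁺ * (1 - u))).re + (subTr A (X⁻ * (1 + u))).re) := by
  have h1 := CFC.posPart_sub_negPart X hX
  have h2 := CFC.posPart_add_negPart X hX
  have h3 : X * u = CFC.abs X - (X⁺ * (1 - u) + X⁻ * (1 + u)) := by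
    rw [← h2]
    conv_lhs => rw [← h1]
    noncomm_ring
  rw [h3]; simp

lemma subTr_mul_re_le_traceNorm {X u : A} (hX : IsSelfAdjoint X) (h1 : -1 ≤ u) (h2 : u ≤ 1) :
    (subTr A (X * u)).re ≤ traceNorm (X : H →L[ℂ] H) := by
  rw [subTr_mul_eq_sub hX, traceNorm_coe]
  have := subTr_mul_re_nonneg (CFC.posPart_nonneg X) (sub_nonneg.2 h2)
  have := subTr_mul_re_nonneg (CFC.negPart_nonneg X) (neg_le_iff_add_nonneg'.1 h1)
  linarith

lemma mul_eq_abs_of_subTr_mul {X u : A} (hX : IsSelfAdjoint X) (h1 : -1 ≤ u) (h2 : u ≤ 1)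
    (h : (subTr A (X * u)).re = traceNorm (X : H →L[ℂ] H)) : X * u = CFC.abs X := by
  rw [subTr_mul_eq_sub hX, traceNorm_coe] at h
  have e1 := subTr_mul_re_nonneg (CFC.posPart_nonneg X) (sub_nonneg.2 h2)
  have e2 := subTr_mul_re_nonneg (CFC.negPart_nonneg X) (neg_le_iff_add_nonneg'.1 h1)
  have f1 := mul_eq_zero_of_subTr_mul (CFC.posPart_nonneg X) (sub_nonneg.2 h2) (by linarith)
  have f2 := mul_eq_zero_of_subTr_mul (CFC.negPart_nonneg X) (neg_le_iff_add_nonneg'.1 h1)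
    (by linarith)
  have h1 := CFC.posPart_sub_negPart X hX
  have h2 := CFC.posPart_add_negPart X hX
  have h3 : X * u = CFC.abs X - (X⁺ * (1 - u) + X⁻ * (1 + u)) := by
    rw [← h2]
    conv_lhs => rw [← h1]
    noncomm_ring
  rw [h3, f1, f2]; simp

/-- `p` is the orthogonal projection of `A` onto the kernel of `X`. -/
structure IsKerProj (X p : A) : Prop where
  isSelfAdjoint : star p = p
  idem : p * p = p
  mul_eq_zero : X * p = 0
  mul_eq_self : ∀ c, X * c = 0 → p * c = c

/-- The projection onto the kernel of a selfadjoint element. -/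
def kerProj (X : A) : A := cfc (fun x : ℝ => if x = 0 then 1 else 0) X

/-- The sign of a selfadjoint element. -/
def sgn (X : A) : A := cfc (fun x : ℝ => SignType.sign x : ℝ → ℝ) X

lemma isKerProj_kerProj {X : A} (hX : IsSelfAdjoint X) : IsKerProj X (kerProj X) where
  isSelfAdjoint := (cfc_predicate _ X : IsSelfAdjoint _).star_eq
  idem := by
    rw [kerProj, ← cfc_mul _ _ X (continuousOn_spectrum_real _ _) (continuousOn_spectrum_real _ _)]
    exact cfc_congr fun x _ => by simp
  mul_eq_zero := by
    have : X * kerProj X = cfc (fun x : ℝ => x) X * kerProj X := by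
      rw [cfc_id' ℝ X]
    rw [this, kerProj, ← cfc_mul _ _ X (continuousOn_spectrum_real _ _)
      (continuousOn_spectrum_real _ _), ← cfc_zero ℝ X]
    exact cfc_congr fun x _ => by simp
  mul_eq_self c hc := by
    have : kerProj X = 1 - cfc (fun x : ℝ => x⁻¹) X * X := by
      conv_rhs => rw [← cfc_one ℝ X]; right; right; rw [← cfc_id' ℝ X]
      rw [← cfc_mul _ _ X (continuousOn_spectrum_real _ _) (continuousOn_spectrum_real _ _),
        ← cfc_sub _ _ X (continuousOn_spectrum_real _ _) (continuousOn_spectrum_real _ _)]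
      exact cfc_congr fun x _ => by
        by_cases hx : x = 0 <;> simp [hx]
    rw [this, sub_mul, mul_assoc, hc]; simp

lemma sgn_add_smul_kerProj {X : A} (c : ℝ) :
    sgn X + c • kerProj X = cfc (fun x : ℝ => SignType.sign x + c * if x = 0 then 1 else 0) X := by
  rw [cfc_add (hf := continuousOn_spectrum_real _ _) (hg := continuousOn_spectrum_real _ _),
    cfc_const_mul c (fun x : ℝ => if x = 0 then 1 else 0) X (continuousOn_spectrum_real _ _)]
  rfl

/-- A norming element of `X` is arbitrary on the kernel of `X`; this freedom is the source of the
jump in the slope of the trace norm. -/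
lemma sgn_add_smul_kerProj_le {X : A} (hX : IsSelfAdjoint X) {c : ℝ} (hc : |c| ≤ 1) :
    sgn X + c • kerProj X ≤ 1 := by
  rw [sgn_add_smul_kerProj, ← cfc_one ℝ X]
  refine cfc_mono (fun x _ => ?_) (continuousOn_spectrum_real _ _) (continuousOn_spectrum_real _ _)
  rcases lt_trichotomy x 0 with h | h | h
  · simp [h, h.ne]
  · simpa [h] using (abs_le.1 hc).2
  · simp [h, h.ne']

lemma neg_one_le_sgn_add_smul_kerProj {X : A} (hX : IsSelfAdjoint X) {c : ℝ} (hc : |c| ≤ 1) :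
    -1 ≤ sgn X + c • kerProj X := by
  rw [sgn_add_smul_kerProj, ← cfc_one ℝ X, ← cfc_neg]
  refine cfc_mono (fun x _ => ?_) (continuousOn_spectrum_real _ _) (continuousOn_spectrum_real _ _)
  rcases lt_trichotomy x 0 with h | h | h
  · simp [h, h.ne]
  · simpa [h] using (abs_le.1 hc).1
  · simp [h, h.ne']

lemma mul_sgn {X : A} (hX : IsSelfAdjoint X) : X * sgn X = CFC.abs X := by
  have : X * sgn X = cfc (fun x : ℝ => x) X * sgn X := by rw [cfc_id' ℝ X]
  rw [this, sgn, ← cfc_mul _ _ X (continuousOn_spectrum_real _ _)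
    (continuousOn_spectrum_real _ _), CFC.abs_eq_cfc_norm X hX]
  exact cfc_congr fun x _ => by simp

lemma mul_sgn_add_smul_kerProj {X : A} (hX : IsSelfAdjoint X) (c : ℝ) :
    X * (sgn X + c • kerProj X) = CFC.abs X := by
  rw [mul_add, mul_sgn hX, mul_smul_comm, (isKerProj_kerProj hX).mul_eq_zero, smul_zero, add_zero]

/-! ### Schwarz maps -/

namespace IsUnitalSchwarz

variable {Φ : A →ₗ[ℂ] B} (hΦ : IsUnitalSchwarz Φ)
include hΦ

lemma star_mul_le (a : A) : star (Φ a) * Φ a ≤ Φ (star a * a) := hΦ.2 a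

lemma map_nonneg {a : A} (ha : 0 ≤ a) : 0 ≤ Φ a := by
  obtain ⟨c, rfl⟩ := nonneg_iff_exists.1 ha
  exact (star_mul_self_nonneg _).trans (hΦ.star_mul_le c)

lemma mono {a b : A} (h : a ≤ b) : Φ a ≤ Φ b := by
  rw [← sub_nonneg, ← map_sub]
  exact hΦ.map_nonneg (sub_nonneg.2 h)

/-- Polarization: every element is a combination of four squares, and images of squares are
positive, hence selfadjoint. -/
lemma map_star (a : A) : Φ (star a) = star (Φ a) := by
  have key : ∀ x : A, star (Φ (star x * x)) = Φ (star x * x) := fun x =>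
    (IsSelfAdjoint.of_nonneg (hΦ.map_nonneg (star_mul_self_nonneg x))).star_eq
  have e : a = (1 / 4 : ℂ) • (star (1 + a) * (1 + a)) - (1 / 4 : ℂ) • (star (1 - a) * (1 - a))
      - (Complex.I / 4) • (star (1 + Complex.I • a) * (1 + Complex.I • a))
      + (Complex.I / 4) • (star (1 - Complex.I • a) * (1 - Complex.I • a)) := by
    simp only [star_add, star_sub, star_one, star_smul, mul_add, add_mul, mul_sub, sub_mul,
      mul_one, one_mul, smul_mul_assoc, mul_smul_comm, smul_add, smul_sub, smul_smul]
    simp only [RCLike.star_def, Complex.conj_I]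
    match_scalars <;> ring_nf <;> simp [Complex.I_sq]
    ring_nf
  have e' : star a = (1 / 4 : ℂ) • (star (1 + a) * (1 + a))
      - (1 / 4 : ℂ) • (star (1 - a) * (1 - a))
      + (Complex.I / 4) • (star (1 + Complex.I • a) * (1 + Complex.I • a))
      - (Complex.I / 4) • (star (1 - Complex.I • a) * (1 - Complex.I • a)) := by
    simp only [star_add, star_sub, star_one, star_smul, mul_add, add_mul, mul_sub, sub_mul,
      mul_one, one_mul, smul_mul_assoc, mul_smul_comm, smul_add, smul_sub, smul_smul]
    simp only [RCLike.star_def, Complex.conj_I]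
    match_scalars <;> ring_nf <;> simp [Complex.I_sq]
    ring_nf
  have gen : ∀ p q r t : A, star (Φ p) = Φ p → star (Φ q) = Φ q → star (Φ r) = Φ r →
      star (Φ t) = Φ t →
      a = (1 / 4 : ℂ) • p - (1 / 4 : ℂ) • q - (Complex.I / 4) • r + (Complex.I / 4) • t →
      star a = (1 / 4 : ℂ) • p - (1 / 4 : ℂ) • q + (Complex.I / 4) • r - (Complex.I / 4) • t →
      Φ (star a) = star (Φ a) := by
    intro p q r t hp hq hr ht h1 h2
    rw [h2]
    conv_rhs => rw [h1]
    simp only [map_add, map_sub, map_smul, star_add, star_sub, star_smul, hp, hq, hr, ht]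
    simp [neg_div]
    abel
  exact gen _ _ _ _ (key _) (key _) (key _) (key _) e e'

lemma map_neg_one_le {a : A} (h : -1 ≤ a) : -1 ≤ Φ a := by
  have := hΦ.mono h
  rwa [map_neg, hΦ.1] at this

lemma map_le_one {a : A} (h : a ≤ 1) : Φ a ≤ 1 := by
  have := hΦ.mono h
  rwa [hΦ.1] at this

/-- The multiplicative domain: equality in the Schwarz inequality at `a` gives multiplicativity
on products with right factor `a`. -/
lemma map_mul_right {a : A} (ha : Φ (star a * a) = star (Φ a) * Φ a) (x : A) :
    Φ (x * a) = Φ x * Φ a := by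
  -- The Schwarz defect is a positive sesquilinear form with `D a a = 0`; as for Cauchy–Schwarz, `D
  -- y a` must vanish.
  set D : A → A → B := fun x y => Φ (star x * y) - star (Φ x) * Φ y with hD
  have hexp : ∀ (y : A) (l : ℂ), D (y + l • a) (y + l • a) =
      D y y + l • D y a + star l • D a y := by
    intro y l
    simp only [hD, map_add, map_smul, star_add, star_smul, mul_add, add_mul, smul_mul_assoc,
      mul_smul_comm, ha, smul_sub, smul_add]
    abel
  have hstar : ∀ y, D a y = star (D y a) := by
    intro y
    simp only [hD, star_sub, star_mul, star_star, ← hΦ.map_star]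
  have hzero : ∀ y, D y a = 0 := by
    intro y
    have hv : ∀ v : K, inner ℂ (((D y a : B) : K →L[ℂ] K) v) v = 0 := by
      intro v
      set z := inner ℂ (((D y a : B) : K →L[ℂ] K) v) v with hz
      have hpos : ∀ l : ℂ, 0 ≤ (inner ℂ (((D y y : B) : K →L[ℂ] K) v) v).re +
          2 * (star l * z).re := by
        intro l
        have h0 : 0 ≤ D (y + l • a) (y + l • a) := sub_nonneg.2 (hΦ.star_mul_le _)
        rw [hexp, hstar] at h0
        have h1 := ((ContinuousLinearMap.nonneg_iff_isPositive _).1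
          (coe_nonneg.2 h0)).inner_nonneg_left v
        have h2 := (Complex.le_def.1 h1).1
        have h3 : inner ℂ ((star ((D y a : B) : K →L[ℂ] K)) v) v = star z := by
          rw [ContinuousLinearMap.star_eq_adjoint, ContinuousLinearMap.adjoint_inner_left, hz]
          exact (inner_conj_symm _ _).symm
        change 0 ≤ (inner ℂ (((D y y : B) : K →L[ℂ] K) v + l • (((D y a : B) : K →L[ℂ] K) v) +
          star l • (star ((D y a : B) : K →L[ℂ] K)) v) v).re at h2
        rw [inner_add_left, inner_add_left, inner_smul_left, inner_smul_left, h3, ← hz] at h2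
        simp at h2 ⊢
        linarith
      set r := (inner ℂ (((D y y : B) : K →L[ℂ] K) v) v).re
      have h5 := hpos 0
      simp only [star_zero, zero_mul, Complex.zero_re, mul_zero, add_zero] at h5
      -- This multiple of `z` turns the bound into `0 ≤ r - 2(r + 1)`, contradicting `0 ≤ r`, which
      -- is the case `l = 0`.
      have h6 := hpos (-(((Complex.normSq z)⁻¹ * (r + 1) : ℝ) : ℂ) * z)
      have h7 : (star (-(((Complex.normSq z)⁻¹ * (r + 1) : ℝ) : ℂ) * z) * z).re =
          -((Complex.normSq z)⁻¹ * (r + 1)) * Complex.normSq z := by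
        simp [Complex.normSq_apply]; ring
      by_contra hne
      have h8 : Complex.normSq z ≠ 0 := by simpa using hne
      rw [h7, neg_mul, mul_right_comm, inv_mul_cancel₀ h8] at h6
      linarith
    have := (inner_map_self_eq_zero (((D y a : B) : K →L[ℂ] K) : K →ₗ[ℂ] K)).1 hv
    exact Subtype.ext (ContinuousLinearMap.coe_injective this)
  have := hzero (star x)
  simp only [hD, star_star, ← hΦ.map_star] at this
  exact sub_eq_zero.1 this

lemma map_mul_left {a : A} (ha : Φ (a * star a) = Φ a * star (Φ a)) (x : A) :
    Φ (a * x) = Φ a * Φ x := by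
  have := hΦ.map_mul_right (a := star a) (by simpa [hΦ.map_star] using ha) (star x)
  rw [← star_mul, hΦ.map_star, hΦ.map_star, hΦ.map_star, ← star_mul] at this
  exact star_injective this

lemma comp {Θ : B →ₗ[ℂ] C} (hΘ : IsUnitalSchwarz Θ) : IsUnitalSchwarz (Θ ∘ₗ Φ) := by
  refine ⟨by simp [hΦ.1, hΘ.1], fun a => ?_⟩
  exact (hΘ.star_mul_le (Φ a)).trans (hΘ.mono (hΦ.star_mul_le a))

end IsUnitalSchwarz

/-! ### The Hilbert-Schmidt adjoint -/

lemma subTr_star (x : A) : subTr A (star x) = star (subTr A x) := by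
  change LinearMap.trace ℂ H _ = star (LinearMap.trace ℂ H _)
  rw [LinearMap.trace_eq_sum_inner _ (stdOrthonormalBasis ℂ H),
    LinearMap.trace_eq_sum_inner _ (stdOrthonormalBasis ℂ H), star_sum]
  refine Finset.sum_congr rfl fun i _ => ?_
  change inner ℂ _ ((ContinuousLinearMap.adjoint (x : H →L[ℂ] H)) _) = star _
  rw [ContinuousLinearMap.adjoint_inner_right]
  exact (inner_conj_symm _ _).symm

lemma hsAdjoint_unique {T : A →ₗ[ℂ] B} {Φ : B →ₗ[ℂ] A}
    (h : ∀ a b, subTr A (star (Φ b) * a) = subTr B (star b * T a)) : hsAdjoint T = Φ := by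
  ext1 b
  apply star_injective
  refine eq_of_subTr_mul_right fun a => ?_
  rw [h]
  exact hsAdjoint_spec T a b

lemma hsAdjoint_hsAdjoint (T : A →ₗ[ℂ] B) : hsAdjoint (hsAdjoint T) = T := by
  refine hsAdjoint_unique fun b a => ?_
  have h : subTr A (star (hsAdjoint T b) * a) = subTr B (star b * T a) := hsAdjoint_spec T a b
  have := congrArg star h
  rw [← subTr_star, ← subTr_star, star_mul, star_star, star_mul, star_star] at this
  exact this.symm

lemma subTr_hsAdjoint_mul {T : A →ₗ[ℂ] B} (hT : IsUnitalSchwarz (hsAdjoint T)) (b : B) (a : A) :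
    subTr A (hsAdjoint T b * a) = subTr B (b * T a) := by
  have h : subTr A (star (hsAdjoint T (star b)) * a) = subTr B (star (star b) * T a) :=
    hsAdjoint_spec T a (star b)
  rwa [hT.map_star, star_star, star_star] at h

lemma subTr_map {T : A →ₗ[ℂ] B} (hT : IsUnitalSchwarz (hsAdjoint T)) (a : A) :
    subTr B (T a) = subTr A a := by
  have := subTr_hsAdjoint_mul hT 1 a
  rw [hT.1, one_mul, one_mul] at this
  exact this.symm

/-! ### Preservation of the trace norm along a pencil -/

lemma map_star_of_hsAdjoint {T : A →ₗ[ℂ] B} (hT : IsUnitalSchwarz (hsAdjoint T)) (a : A) :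
    T (star a) = star (T a) := by
  refine eq_of_subTr_mul_left fun b => ?_
  rw [← subTr_hsAdjoint_mul hT, ← star_star b, hT.map_star, ← star_mul, ← star_mul, subTr_star,
    subTr_star, subTr_mul_comm a, subTr_mul_comm (T a), subTr_hsAdjoint_mul hT]

/-- The positive cone is self-dual: testing `T a` against its own negative part gives minus a
squared norm, which must be nonnegative. -/
lemma map_nonneg_of_hsAdjoint {T : A →ₗ[ℂ] B} (hT : IsUnitalSchwarz (hsAdjoint T)) {a : A}
    (ha : 0 ≤ a) : 0 ≤ T a := by
  have hsa : IsSelfAdjoint (T a) := by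
    rw [IsSelfAdjoint, ← map_star_of_hsAdjoint hT, (IsSelfAdjoint.of_nonneg ha).star_eq]
  have h := subTr_mul_re_nonneg (hT.map_nonneg (CFC.negPart_nonneg (T a))) ha
  rw [subTr_hsAdjoint_mul hT] at h
  have e : (T a)⁻ * T a = -((T a)⁻ * (T a)⁻) := by
    nth_rewrite 2 [← CFC.posPart_sub_negPart (T a) hsa]
    rw [mul_sub, CFC.negPart_mul_posPart, zero_sub]
  have hneg : star (T a)⁻ = (T a)⁻ := (IsSelfAdjoint.of_nonneg (CFC.negPart_nonneg (T a))).star_eq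
  have h1 := subTr_star_mul_self_re_nonneg (T a)⁻
  rw [e, map_neg, Complex.neg_re] at h
  rw [hneg] at h1
  have h0 : (T a)⁻ = 0 := eq_zero_of_subTr_star_mul_self (by rw [hneg]; linarith)
  exact (CFC.negPart_eq_zero_iff (T a) hsa).1 h0

/-! ### Norming elements and kernel projections -/

lemma exists_norming {X : A} (hX : IsSelfAdjoint X) :
    -1 ≤ sgn X ∧ sgn X ≤ 1 ∧ (subTr A (X * sgn X)).re = traceNorm (X : H →L[ℂ] H) := by
  refine ⟨by simpa using neg_one_le_sgn_add_smul_kerProj hX (c := 0) (by simp),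
    by simpa using sgn_add_smul_kerProj_le hX (c := 0) (by simp), ?_⟩
  rw [mul_sgn hX, traceNorm_coe]

/-- The trace norm is contracted by adjoints of unital Schwarz maps. -/
lemma traceNorm_map_le {T : A →ₗ[ℂ] B} (hT : IsUnitalSchwarz (hsAdjoint T)) {X : A}
    (hX : IsSelfAdjoint X) : traceNorm (T X : K →L[ℂ] K) ≤ traceNorm (X : H →L[ℂ] H) := by
  have hTX : IsSelfAdjoint (T X) := by
    rw [IsSelfAdjoint, ← map_star_of_hsAdjoint hT, hX.star_eq]
  obtain ⟨h1, h2, h3⟩ := exists_norming hTX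
  rw [← h3, subTr_mul_comm, ← subTr_hsAdjoint_mul hT, subTr_mul_comm]
  exact subTr_mul_re_le_traceNorm hX (hT.map_neg_one_le h1) (hT.map_le_one h2)

lemma traceNorm_of_nonneg {X : A} (hX : 0 ≤ X) :
    traceNorm (X : H →L[ℂ] H) = (subTr A X).re := by
  rw [traceNorm_coe, CFC.abs_of_nonneg X hX]

lemma isCompact_Icc_neg_one_one : IsCompact (Set.Icc (-1 : A) 1) := by
  refine Metric.isCompact_of_isClosed_isBounded isClosed_Icc ?_
  refine (Metric.isBounded_iff_subset_closedBall (-1)).2 ⟨‖(1 + 1 : A)‖, fun v hv => ?_⟩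
  rw [mem_closedBall_iff_norm]
  refine CStarAlgebra.norm_le_norm_of_nonneg_of_le (sub_nonneg.2 hv.1) ?_
  rw [sub_neg_eq_add]
  exact add_le_add hv.2 le_rfl

lemma IsKerProj.conj_eq {X p d : A} (hp : IsKerProj X p) (hd : star d = d) (h : X * d = 0) :
    p * d * p = d := by
  have h1 := hp.mul_eq_self d h
  have h2 : d * p = d := by
    have := congrArg star h1
    rwa [star_mul, hp.isSelfAdjoint, hd] at this
  rw [h1, h2]

/-- Compress the bound by `p`: `d` is unchanged and the identity becomes `p`. -/
lemma IsKerProj.le_smul {X p d : A} (hp : IsKerProj X p) (hd : star d = d) (h : X * d = 0) {r : ℝ}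
    (hr : d ≤ (r : ℂ) • 1) : d ≤ (r : ℂ) • p := by
  have := star_left_conjugate_le_conjugate hr p
  rw [hp.isSelfAdjoint, hp.conj_eq hd h] at this
  simpa [hp.idem] using this

lemma IsKerProj.unique {X p q : A} (hp : IsKerProj X p) (hq : IsKerProj X q) : p = q := by
  have h1 := hp.mul_eq_self q hq.mul_eq_zero
  have h2 := congrArg star (hq.mul_eq_self p hp.mul_eq_zero)
  rw [star_mul, hp.isSelfAdjoint, hq.isSelfAdjoint] at h2
  exact h2.symm.trans h1

/-- If `T` preserves the trace norm of `X`, its adjoint maps the kernel projection of `T X` below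
the kernel projection of `X`. -/
lemma mul_hsAdjoint_kerProj {T : A →ₗ[ℂ] B} (hT : IsUnitalSchwarz (hsAdjoint T)) {X : A}
    (hX : IsSelfAdjoint X) (h : traceNorm (X : H →L[ℂ] H) = traceNorm (T X : K →L[ℂ] K)) :
    X * hsAdjoint T (kerProj (T X)) = 0 := by
  have hTX : IsSelfAdjoint (T X) := by
    rw [IsSelfAdjoint, ← map_star_of_hsAdjoint hT, hX.star_eq]
  -- Norming elements of `T X` pull back to norming elements of `X`. Subtracting the cases `c = 1`
  -- and `c = 0` isolates the kernel projection.
  have key : ∀ c : ℝ, |c| ≤ 1 →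
      X * hsAdjoint T (sgn (T X) + c • kerProj (T X)) = CFC.abs X := by
    intro c hc
    refine mul_eq_abs_of_subTr_mul hX
      (hT.map_neg_one_le (neg_one_le_sgn_add_smul_kerProj hTX hc))
      (hT.map_le_one (sgn_add_smul_kerProj_le hTX hc)) ?_
    rw [subTr_mul_comm, subTr_hsAdjoint_mul hT, subTr_mul_comm, mul_sgn_add_smul_kerProj hTX, h,
      traceNorm_coe]
  have h1 := key 1 (by simp)
  have h0 := key 0 (by simp)
  rw [zero_smul, add_zero] at h0
  rw [one_smul, map_add, mul_add, h0] at h1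
  simpa using h1

lemma continuous_subTr_mul_re (Z : A) : Continuous fun x : A => (subTr A (Z * x)).re :=
  Complex.continuous_re.comp
    ((LinearMap.continuous_of_finiteDimensional (subTr A)).comp (continuous_const.mul
      continuous_id))

/-- A cluster point of asymptotically norming elements for `X` is norming. -/
lemma exists_tendsto_norming {X Y : A} (hX : IsSelfAdjoint X) {e : ℕ → ℝ} {v : ℕ → A}
    (he : Tendsto e atTop (𝓝 0)) (hv : ∀ n, v n ∈ Set.Icc (-1 : A) 1)
    (h : ∀ n, (subTr A (X * sgn X)).re + e n * (subTr A (Y * sgn X)).re ≤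
      (subTr A (X * v n)).re + e n * (subTr A (Y * v n)).re) :
    ∃ w ∈ Set.Icc (-1 : A) 1, X * w = CFC.abs X ∧ ∃ φ : ℕ → ℕ, StrictMono φ ∧
      Tendsto (fun n => v (φ n)) atTop (𝓝 w) := by
  obtain ⟨w, hw, φ, hφ, hlim⟩ := isCompact_Icc_neg_one_one.tendsto_subseq hv
  refine ⟨w, hw, ?_, φ, hφ, hlim⟩
  refine mul_eq_abs_of_subTr_mul hX hw.1 hw.2
    (le_antisymm (subTr_mul_re_le_traceNorm hX hw.1 hw.2) ?_)
  have heφ : Tendsto (fun n => e (φ n)) atTop (𝓝 0) := he.comp hφ.tendsto_atTop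
  have t1 : Tendsto (fun n => (subTr A (X * v (φ n))).re + e (φ n) * (subTr A (Y * v (φ n))).re)
      atTop (𝓝 ((subTr A (X * w)).re + 0 * (subTr A (Y * w)).re)) :=
    (((continuous_subTr_mul_re X).tendsto w).comp hlim).add
      (heφ.mul (((continuous_subTr_mul_re Y).tendsto w).comp hlim))
  have t2 : Tendsto (fun n => (subTr A (X * sgn X)).re + e (φ n) * (subTr A (Y * sgn X)).re) atTop
      (𝓝 ((subTr A (X * sgn X)).re + 0 * (subTr A (Y * sgn X)).re)) :=
    tendsto_const_nhds.add (heφ.mul tendsto_const_nhds)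
  have hle := le_of_tendsto_of_tendsto' t2 t1 fun n => h (φ n)
  rw [(exists_norming hX).2.2] at hle
  linarith

/-- A test element bounding the jump of the derivative of the trace norm at `X`. -/
lemma exists_le_of_second_difference {T : A →ₗ[ℂ] B} (hT : IsUnitalSchwarz (hsAdjoint T)) {X Y : A}
    (hX : IsSelfAdjoint X) (hY : 0 ≤ Y)
    (h : ∀ e : ℝ, traceNorm ((X + (e : ℂ) • Y : A) : H →L[ℂ] H) =
      traceNorm (T (X + (e : ℂ) • Y) : K →L[ℂ] K)) :
    ∃ d : B, star d = d ∧ T X * d = 0 ∧ d ≤ ((2 : ℝ) : ℂ) • 1 ∧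
      2 * (subTr A (Y * kerProj X)).re ≤ (subTr B (T Y * d)).re := by
  have hsa : ∀ {Z : A}, IsSelfAdjoint Z → IsSelfAdjoint (T Z) := fun {Z} hZ => by
    rw [IsSelfAdjoint, ← map_star_of_hsAdjoint hT, hZ.star_eq]
  have hXe : ∀ e : ℝ, IsSelfAdjoint (X + (e : ℂ) • Y) := fun e => by
    rw [IsSelfAdjoint, star_add, star_smul, hX.star_eq, (IsSelfAdjoint.of_nonneg hY).star_eq]
    simp
  set v : ℝ → B := fun e => sgn (T (X + (e : ℂ) • Y)) with hv
  have hv1 : ∀ e, v e ∈ Set.Icc (-1 : B) 1 := fun e =>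
    ⟨(exists_norming (hsa (hXe e))).1, (exists_norming (hsa (hXe e))).2.1⟩
  have hvn : ∀ e : ℝ, (subTr B (T (X + (e : ℂ) • Y) * v e)).re =
      traceNorm ((X + (e : ℂ) • Y : A) : H →L[ℂ] H) := fun e => by
    rw [h]; exact (exists_norming (hsa (hXe e))).2.2
  have hlin : ∀ (e : ℝ) (w : B), (subTr B (T (X + (e : ℂ) • Y) * w)).re =
      (subTr B (T X * w)).re + e * (subTr B (T Y * w)).re := by
    intro e w
    simp [add_mul]
  have hlinA : ∀ (e : ℝ) (w : A), (subTr A ((X + (e : ℂ) • Y) * w)).re =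
      (subTr A (X * w)).re + e * (subTr A (Y * w)).re := by
    intro e w
    simp [add_mul]
  have hXT : traceNorm (X : H →L[ℂ] H) = traceNorm (T X : K →L[ℂ] K) := by simpa using h 0
  -- Test `X + eY` with `sgn X + kerProj X` and `X - eY` with `sgn X - kerProj X`, bound the `T X`
  -- terms by `‖X‖₁`, and add: everything of order zero cancels.
  have hdiff : ∀ e : ℝ, 0 < e →
      2 * (subTr A (Y * kerProj X)).re ≤ (subTr B (T Y * (v e - v (-e)))).re := by
    intro e he
    have a1 := subTr_mul_re_le_traceNorm (hXe e)
      (neg_one_le_sgn_add_smul_kerProj hX (c := 1) (by simp))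
      (sgn_add_smul_kerProj_le hX (c := 1) (by simp))
    have a2 := subTr_mul_re_le_traceNorm (hXe (-e))
      (neg_one_le_sgn_add_smul_kerProj hX (c := -1) (by simp))
      (sgn_add_smul_kerProj_le hX (c := -1) (by simp))
    rw [← hvn, hlin, hlinA, mul_sgn_add_smul_kerProj hX, ← traceNorm_coe] at a1 a2
    have b1 := subTr_mul_re_le_traceNorm (hsa hX) (hv1 e).1 (hv1 e).2
    have b2 := subTr_mul_re_le_traceNorm (hsa hX) (hv1 (-e)).1 (hv1 (-e)).2
    rw [← hXT] at b1 b2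
    have c1 : (subTr A (Y * (sgn X + (1 : ℝ) • kerProj X))).re =
        (subTr A (Y * sgn X)).re + (subTr A (Y * kerProj X)).re := by
      simp [mul_add]
    have c2 : (subTr A (Y * (sgn X + (-1 : ℝ) • kerProj X))).re =
        (subTr A (Y * sgn X)).re - (subTr A (Y * kerProj X)).re := by
      simp [mul_add, sub_eq_add_neg]
    rw [c1] at a1
    rw [c2] at a2
    rw [mul_sub, map_sub, Complex.sub_re]
    have : e * (2 * (subTr A (Y * kerProj X)).re) ≤
        e * ((subTr B (T Y * v e)).re - (subTr B (T Y * v (-e))).re) := by linarith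
    exact le_of_mul_le_mul_left this he
  have hlim : ∀ (e : ℕ → ℝ), Tendsto e atTop (𝓝 0) → ∃ w ∈ Set.Icc (-1 : B) 1,
      T X * w = CFC.abs (T X) ∧ ∃ φ : ℕ → ℕ, StrictMono φ ∧
        Tendsto (fun n => v (e (φ n))) atTop (𝓝 w) := by
    intro e he
    refine exists_tendsto_norming (Y := T Y) (hsa hX) he (fun n => hv1 (e n)) fun n => ?_
    rw [← hlin, ← hlin, hvn, h]
    obtain ⟨s1, s2, -⟩ := exists_norming (hsa hX)
    exact subTr_mul_re_le_traceNorm (hsa (hXe _)) s1 s2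
  have h0 : Tendsto (fun n : ℕ => 1 / ((n : ℝ) + 1)) atTop (𝓝 0) :=
    tendsto_one_div_add_atTop_nhds_zero_nat
  obtain ⟨w, hw, hwX, φ, hφ, hlimw⟩ := hlim _ h0
  have h0φ := h0.comp hφ.tendsto_atTop
  -- The second extraction refines the first, so one sequence of step sizes serves both one-sided
  -- limits. Both norm `T X`, so their difference is killed by `T X`.
  obtain ⟨u, hu, huX, ψ, hψ, hlimu⟩ := hlim (fun n => -(1 / ((φ n : ℝ) + 1)))
    (by simpa using h0φ.neg)
  have hd : Tendsto (fun n => (subTr B (T Y * (v (1 / ((φ (ψ n) : ℝ) + 1)) -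
      v (-(1 / ((φ (ψ n) : ℝ) + 1)))))).re) atTop (𝓝 (subTr B (T Y * (w - u))).re) := by
    have h1 := (hlimw.comp hψ.tendsto_atTop).sub hlimu
    exact ((continuous_subTr_mul_re (T Y)).tendsto (w - u)).comp h1
  have hle1 : 2 * (subTr A (Y * kerProj X)).re ≤ (subTr B (T Y * (w - u))).re :=
    ge_of_tendsto' hd fun n => hdiff _ (by positivity)
  have hsaI : ∀ {x : B}, x ∈ Set.Icc (-1 : B) 1 → star x = x := by
    intro x hx
    have := (IsSelfAdjoint.of_nonneg (sub_nonneg.2 hx.2)).star_eq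
    rw [star_sub, star_one] at this
    exact sub_right_injective this
  have hwu : w - u ≤ ((2 : ℝ) : ℂ) • 1 := by
    have : w - u ≤ 1 - (-1) := sub_le_sub hw.2 hu.1
    refine this.trans (le_of_eq ?_)
    rw [sub_neg_eq_add, Complex.ofReal_ofNat, two_smul]
  exact ⟨w - u, by rw [star_sub, hsaI hw, hsaI hu], by rw [mul_sub, hwX, huX, sub_self], hwu, hle1⟩

/-- If `T` preserves the trace norm along the line through `X` in the direction of an invertible
positive `Y`, its adjoint maps the kernel projection of `T X` to that of `X`. -/
theorem hsAdjoint_kerProj {T : A →ₗ[ℂ] B} (hT : IsUnitalSchwarz (hsAdjoint T)) {X Y : A}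
    (hX : IsSelfAdjoint X) (hY : 0 ≤ Y) (hYu : IsUnit Y)
    (h : ∀ e : ℝ, traceNorm ((X + (e : ℂ) • Y : A) : H →L[ℂ] H) =
      traceNorm (T (X + (e : ℂ) • Y) : K →L[ℂ] K)) :
    hsAdjoint T (kerProj (T X)) = kerProj X := by
  have hsa : ∀ {Z : A}, IsSelfAdjoint Z → IsSelfAdjoint (T Z) := fun {Z} hZ => by
    rw [IsSelfAdjoint, ← map_star_of_hsAdjoint hT, hZ.star_eq]
  obtain ⟨d, hds, hXd, hd2, hle1⟩ := exists_le_of_second_difference hT hX hY h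
  set p := kerProj X with hpdef
  have hp : IsKerProj X p := isKerProj_kerProj hX
  set q := kerProj (T X) with hqdef
  have hq : IsKerProj (T X) q := isKerProj_kerProj (hsa hX)
  set c := hsAdjoint T q with hcdef
  have hXc : X * c = 0 := mul_hsAdjoint_kerProj hT hX (by simpa using h 0)
  have hcs : star c = c := by rw [hcdef, ← hT.map_star, hq.isSelfAdjoint]
  have hq1 : q ≤ 1 := by
    have h0 := star_mul_self_nonneg (1 - q)
    rw [star_sub, star_one, hq.isSelfAdjoint, mul_sub, sub_mul, sub_mul, hq.idem] at h0
    simpa using h0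
  have hcp : c ≤ p := by
    have := hp.le_smul hcs hXc (r := 1) (by simpa using hT.map_le_one hq1)
    simpa using this
  have hdq : d ≤ ((2 : ℝ) : ℂ) • q := hq.le_smul hds hXd hd2
  -- Closes the chain `2 Tr(Yp) ≤ Tr(T(Y)d) ≤ 2 Tr(T(Y)q) = 2 Tr(Yc)`, while `c ≤ p` gives the
  -- reverse inequality.
  have hle2 : (subTr B (T Y * d)).re ≤ 2 * (subTr A (Y * c)).re := by
    have := subTr_mul_re_nonneg (map_nonneg_of_hsAdjoint hT hY) (sub_nonneg.2 hdq)
    rw [mul_sub, map_sub, Complex.sub_re, mul_smul_comm, map_smul, smul_eq_mul,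
      Complex.re_ofReal_mul, subTr_mul_comm (T Y) q, ← subTr_hsAdjoint_mul hT,
      subTr_mul_comm] at this
    linarith
  have hpos := subTr_mul_re_nonneg hY (sub_nonneg.2 hcp)
  have hzero : Y * (p - c) = 0 := by
    refine mul_eq_zero_of_subTr_mul hY (sub_nonneg.2 hcp) (le_antisymm ?_ hpos)
    rw [mul_sub, map_sub, Complex.sub_re]
    linarith
  exact (sub_eq_zero.1 ((hYu.mul_right_eq_zero).1 hzero)).symm

/-! ### Powers and spectral projections of an invertible positive element -/

lemma spectrum_pos {ρ : A} (hρ : 0 ≤ ρ) (hu : IsUnit ρ) {w : ℂ} (hw : w ∈ spectrum ℂ ρ) :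
    ∃ r : ℝ, 0 < r ∧ w = r := by
  have hre := (IsSelfAdjoint.of_nonneg hρ).mem_spectrum_eq_re hw
  refine ⟨w.re, ?_, hre⟩
  have h0 : 0 ≤ w.re := by
    refine spectrum_nonneg_of_nonneg hρ ?_
    rw [← spectrum.preimage_algebraMap ℂ]
    simpa [← hre] using hw
  refine lt_of_le_of_ne h0 fun h => ?_
  rw [hre, ← h] at hw
  exact spectrum.zero_notMem ℂ hu (by simpa using hw)

lemma opPow_add {ρ : A} (hρ : 0 ≤ ρ) (hu : IsUnit ρ) (z w : ℂ) :
    opPow ρ (z + w) = opPow ρ z * opPow ρ w := by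
  rw [opPow, opPow, opPow, ← cfc_mul _ _ ρ (continuousOn_spectrum_complex _ _)
    (continuousOn_spectrum_complex _ _)]
  refine cfc_congr fun x hx => ?_
  obtain ⟨r, hr, rfl⟩ := spectrum_pos hρ hu hx
  exact Complex.cpow_add _ _ (by exact_mod_cast hr.ne')

lemma opPow_zero {ρ : A} (hρ : 0 ≤ ρ) : opPow ρ 0 = 1 := by
  have : IsStarNormal ρ := (IsSelfAdjoint.of_nonneg hρ).isStarNormal
  rw [opPow, ← cfc_one ℂ ρ]
  exact cfc_congr fun x _ => by simp

lemma opPow_one {ρ : A} (hρ : 0 ≤ ρ) : opPow ρ 1 = ρ := by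
  have : IsStarNormal ρ := (IsSelfAdjoint.of_nonneg hρ).isStarNormal
  conv_rhs => rw [← cfc_id' ℂ ρ]
  exact cfc_congr fun x _ => by simp

lemma opPow_mul_neg {ρ : A} (hρ : 0 ≤ ρ) (hu : IsUnit ρ) (z : ℂ) :
    opPow ρ z * opPow ρ (-z) = 1 := by
  rw [← opPow_add hρ hu, add_neg_cancel, opPow_zero hρ]

lemma opPow_neg_mul {ρ : A} (hρ : 0 ≤ ρ) (hu : IsUnit ρ) (z : ℂ) :
    opPow ρ (-z) * opPow ρ z = 1 := by
  rw [← opPow_add hρ hu, neg_add_cancel, opPow_zero hρ]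

lemma opPow_half_mul_half {ρ : A} (hρ : 0 ≤ ρ) (hu : IsUnit ρ) :
    opPow ρ (1 / 2) * opPow ρ (1 / 2) = ρ := by
  rw [← opPow_add hρ hu, add_halves, opPow_one hρ]

/-- Conjugation commutes with complex powers off the branch cut, and the spectrum of `ρ` is strictly
positive. -/
lemma star_opPow {ρ : A} (hρ : 0 ≤ ρ) (hu : IsUnit ρ) (z : ℂ) :
    star (opPow ρ z) = opPow ρ (star z) := by
  rw [opPow, opPow, ← cfc_star]
  refine cfc_congr fun x hx => ?_
  obtain ⟨r, hr, rfl⟩ := spectrum_pos hρ hu hx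
  have h := Complex.cpow_conj (r : ℂ) z
    (by rw [Complex.arg_ofReal_of_nonneg hr.le]; exact Real.pi_ne_zero.symm)
  rw [Complex.conj_ofReal] at h
  exact h.symm

/-- The spectral projection of `ρ` at the point `l`. -/
def specProj (ρ : A) (l : ℂ) : A := cfc (fun w : ℂ => if w = l then 1 else 0) ρ

lemma cfc_eq_sum_specProj (ρ : A) (f : ℂ → ℂ) :
    cfc f ρ = ∑ l ∈ (finite_spectrum_complex ρ).toFinset, f l • specProj ρ l := by
  have : ∀ l, f l • specProj ρ l = cfc (fun w : ℂ => f l * if w = l then 1 else 0) ρ := fun l => by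
    rw [cfc_const_mul _ _ ρ (continuousOn_spectrum_complex _ _)]
    rfl
  simp_rw [this]
  rw [← cfc_sum _ _ _ fun _ _ => continuousOn_spectrum_complex _ _]
  refine cfc_congr fun x hx => ?_
  simp [Finset.sum_apply, hx]

lemma sum_specProj {ρ : A} (hρ : IsSelfAdjoint ρ) :
    ∑ l ∈ (finite_spectrum_complex ρ).toFinset, specProj ρ l = 1 := by
  have : IsStarNormal ρ := hρ.isStarNormal
  have h := cfc_eq_sum_specProj ρ fun _ => 1
  rw [cfc_const_one ℂ ρ] at h
  simpa using h.symm

lemma opPow_mul_specProj {ρ : A} (z l : ℂ) :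
    opPow ρ z * specProj ρ l = l ^ z • specProj ρ l := by
  rw [specProj, opPow, ← cfc_mul _ _ ρ (continuousOn_spectrum_complex _ _)
    (continuousOn_spectrum_complex _ _), ← cfc_const_mul _ _ ρ (continuousOn_spectrum_complex _ _)]
  exact cfc_congr fun x _ => by
    by_cases hx : x = l <;> simp [hx]

lemma specProj_mul_opPow {ρ : A} (z l : ℂ) :
    specProj ρ l * opPow ρ z = l ^ z • specProj ρ l := by
  rw [← opPow_mul_specProj]
  exact cfc_commute_cfc _ _ ρ

lemma eq_sum_specProj_mul_mul {ρ : A} (hρ : 0 ≤ ρ) (a : A) :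
    a = ∑ x ∈ (finite_spectrum_complex ρ).toFinset ×ˢ (finite_spectrum_complex ρ).toFinset,
      specProj ρ x.1 * a * specProj ρ x.2 := by
  rw [Finset.sum_product]
  simp_rw [← Finset.mul_sum, ← Finset.sum_mul]
  rw [sum_specProj (IsSelfAdjoint.of_nonneg hρ), one_mul, mul_one]

/-- Decomposition of `a` into eigenvectors of the modular group of `ρ`. -/
lemma exists_modular_decomposition {ρ : A} (hρ : 0 ≤ ρ) (hu : IsUnit ρ) (a : A) :
    ∃ (R : Finset ℝ) (f : ℝ → A), (∀ m ∈ R, 0 < m) ∧ a = ∑ m ∈ R, f m ∧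
      ∀ m ∈ R, ∀ z : ℂ, opPow ρ z * f m = (m : ℂ) ^ z • (f m * opPow ρ z) := by
  classical
  set E := (finite_spectrum_complex ρ).toFinset with hE
  have hpos : ∀ l ∈ E, ∃ r : ℝ, 0 < r ∧ l = r := fun l hl =>
    spectrum_pos hρ hu (by simpa [hE] using hl)
  -- A block of `a` between spectral projections at `r` and `t` is a modular eigenvector with ratio
  -- `r / t`; blocks with equal ratio are collected.
  set g : ℂ × ℂ → ℝ := fun x => x.1.re / x.2.re with hg
  refine ⟨(E ×ˢ E).image g,
    fun m => ∑ x ∈ E ×ˢ E with g x = m, specProj ρ x.1 * a * specProj ρ x.2, ?_, ?_, ?_⟩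
  · intro m hm
    obtain ⟨x, hx, rfl⟩ := Finset.mem_image.1 hm
    obtain ⟨r, hr, h1⟩ := hpos _ (Finset.mem_product.1 hx).1
    obtain ⟨t, ht, h2⟩ := hpos _ (Finset.mem_product.1 hx).2
    simp only [hg, h1, h2, Complex.ofReal_re]
    positivity
  · rw [Finset.sum_fiberwise_of_maps_to fun x hx => Finset.mem_image_of_mem g hx]
    exact eq_sum_specProj_mul_mul hρ a
  · intro m _ z
    rw [Finset.mul_sum, Finset.sum_mul, Finset.smul_sum]
    refine Finset.sum_congr rfl fun x hx => ?_
    obtain ⟨hx', rfl⟩ := Finset.mem_filter.1 hx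
    obtain ⟨r, hr, h1⟩ := hpos _ (Finset.mem_product.1 hx').1
    obtain ⟨t, ht, h2⟩ := hpos _ (Finset.mem_product.1 hx').2
    rw [mul_assoc (specProj ρ x.1 * a), specProj_mul_opPow, ← mul_assoc, ← mul_assoc,
      opPow_mul_specProj, mul_smul_comm, smul_smul, smul_mul_assoc, smul_mul_assoc]
    congr 1
    simp only [hg, h1, h2, Complex.ofReal_re]
    rw [← Complex.mul_cpow_ofReal_nonneg (by positivity) ht.le, ← Complex.ofReal_mul,
      div_mul_cancel₀ _ ht.ne']

/-- Eigenvectors of conjugation by `ρ` are eigenvectors of conjugation by its powers. -/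
lemma opPow_mul_of_mul {ρ : A} (hρ : 0 ≤ ρ) (hu : IsUnit ρ) {a : A} {m : ℝ} (hm : 0 < m)
    (h : ρ * a = (m : ℂ) • (a * ρ)) (z : ℂ) :
    opPow ρ z * a = (m : ℂ) ^ z • (a * opPow ρ z) := by
  set E := (finite_spectrum_complex ρ).toFinset with hE
  have hpos : ∀ l ∈ E, ∃ r : ℝ, 0 < r ∧ l = r := fun l hl =>
    spectrum_pos hρ hu (by simpa [hE] using hl)
  -- Sandwiching the hypothesis between spectral projections gives `(l - mk)` times the block equal
  -- to zero.
  have hz : ∀ l k : ℂ, l ≠ m * k → specProj ρ l * a * specProj ρ k = 0 := by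
    intro l k hlk
    have h1 : specProj ρ l * (ρ * a) * specProj ρ k = specProj ρ l * ((m : ℂ) • (a * ρ)) *
      specProj ρ k := by rw [h]
    have e1 : specProj ρ l * ρ = l • specProj ρ l := by
      simpa [opPow_one hρ] using specProj_mul_opPow (ρ := ρ) 1 l
    have e2 : ρ * specProj ρ k = k • specProj ρ k := by
      simpa [opPow_one hρ] using opPow_mul_specProj (ρ := ρ) 1 k
    rw [← mul_assoc, e1, mul_smul_comm, smul_mul_assoc, smul_mul_assoc, smul_mul_assoc,
      ← mul_assoc, mul_assoc (specProj ρ l * a), e2, mul_smul_comm, smul_smul, ← sub_eq_zero,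
      ← sub_smul] at h1
    exact (smul_eq_zero.1 h1).resolve_left (sub_ne_zero.2 hlk)
  rw [eq_sum_specProj_mul_mul hρ a, Finset.mul_sum, Finset.sum_mul, Finset.smul_sum]
  refine Finset.sum_congr rfl fun x hx => ?_
  obtain ⟨r, hr, h1⟩ := hpos _ (Finset.mem_product.1 hx).1
  obtain ⟨t, ht, h2⟩ := hpos _ (Finset.mem_product.1 hx).2
  rw [mul_assoc (specProj ρ x.1 * a), specProj_mul_opPow, ← mul_assoc, ← mul_assoc,
    opPow_mul_specProj, mul_smul_comm, smul_smul, smul_mul_assoc, smul_mul_assoc]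
  by_cases hx : x.1 = m * x.2
  · rw [hx, h2, Complex.mul_cpow_ofReal_nonneg hm.le ht.le]
  · rw [hz _ _ hx, smul_zero, smul_zero]

/-- If all combinations of `f` with the values of distinct characters lie in a subspace, then
so do the coefficients. -/
lemma mem_of_forall_sum_monoidHom_smul_mem {V G : Type*} [AddCommGroup V] [Module ℂ V] [Monoid G]
    (N : Submodule ℂ V) {ι : Type*} (R : Finset ι) (f : ι → V) (χ : R → (G →* ℂ))
    (hχ : Function.Injective χ) (h : ∀ g, ∑ i : R, χ i g • f i ∈ N) (i : R) : f i ∈ N := by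
  rw [← Submodule.Quotient.mk_eq_zero, ← Module.forall_dual_apply_eq_zero_iff ℂ]
  -- A functional on the quotient by `N` turns the hypothesis into a vanishing combination of
  -- distinct characters, which are independent by Dedekind.
  intro φ
  have hli := (linearIndependent_monoidHom G ℂ).comp χ hχ
  rw [Fintype.linearIndependent_iff] at hli
  refine hli (fun j => φ (Submodule.Quotient.mk (f j))) ?_ i
  funext g
  have hg := congrArg φ ((Submodule.Quotient.mk_eq_zero N).2 (h g))
  rw [← Submodule.mkQ_apply, map_sum, map_sum, map_zero] at hg
  simpa [Finset.sum_apply, mul_comm] using hg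

/-! ### Modular orbits and their eigencomponents -/

lemma modConj_eq_sum {ρ : A} (hρ : 0 ≤ ρ) (hu : IsUnit ρ) {R : Finset ℝ} {f : ℝ → A}
    (h : ∀ m ∈ R, ∀ z : ℂ, opPow ρ z * f m = (m : ℂ) ^ z • (f m * opPow ρ z)) (z : ℂ) :
    opPow ρ z * (∑ m ∈ R, f m) * opPow ρ (-z) = ∑ m ∈ R, (m : ℂ) ^ z • f m := by
  rw [Finset.mul_sum, Finset.sum_mul]
  refine Finset.sum_congr rfl fun m hm => ?_
  rw [h m hm, smul_mul_assoc, mul_assoc, opPow_mul_neg hρ hu, mul_one]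

/-- The character `s ↦ m ^ {is}` of the real line. -/
def imPowHom (m : ℝ) (hm : 0 < m) : Multiplicative ℝ →* ℂ where
  toFun s := (m : ℂ) ^ (Complex.I * (s.toAdd : ℂ))
  map_one' := by simp
  map_mul' s t := by
    rw [← Complex.cpow_add _ _ (by exact_mod_cast hm.ne')]
    simp [mul_add]

lemma imPowHom_injective {m n : ℝ} (hm : 0 < m) (hn : 0 < n)
    (h : imPowHom m hm = imPowHom n hn) : m = n := by
  by_contra hne
  have hlog : Real.log m - Real.log n ≠ 0 := sub_ne_zero.2 fun e =>
    hne (Real.log_injOn_pos hm hn e)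
  -- At this `s` the two characters differ by the factor `exp(iπ) = -1`.
  set s : ℝ := Real.pi / (Real.log m - Real.log n) with hs
  have h1 : (m : ℂ) ^ (Complex.I * (s : ℂ)) = (n : ℂ) ^ (Complex.I * (s : ℂ)) :=
    DFunLike.congr_fun h (Multiplicative.ofAdd s)
  rw [Complex.cpow_def_of_ne_zero (by exact_mod_cast hm.ne'),
    Complex.cpow_def_of_ne_zero (by exact_mod_cast hn.ne'), ← Complex.ofReal_log hm.le,
    ← Complex.ofReal_log hn.le] at h1
  have h2 : (Real.log m : ℂ) * (Complex.I * s) =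
      Real.log n * (Complex.I * s) + Real.pi * Complex.I := by
    have : ((Real.log m - Real.log n) * s : ℝ) = Real.pi := by
      rw [hs, mul_div_cancel₀ _ hlog]
    rw [← this]
    push_cast
    ring
  rw [h2, Complex.exp_add, Complex.exp_pi_mul_I] at h1
  have h3 := Complex.exp_ne_zero ((Real.log n : ℂ) * (Complex.I * s))
  exact h3 (by linear_combination (-1 / 2 : ℂ) * h1)

/-- The modular eigencomponents of `a` lie in a subspace containing the modular orbit of `a`. -/
lemma mem_of_forall_modConj_mem {ρ : A} (hρ : 0 ≤ ρ) (hu : IsUnit ρ) {R : Finset ℝ} {f : ℝ → A}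
    (hR : ∀ m ∈ R, 0 < m)
    (h : ∀ m ∈ R, ∀ z : ℂ, opPow ρ z * f m = (m : ℂ) ^ z • (f m * opPow ρ z))
    {N : Submodule ℂ A} (hN : ∀ s, modConj ρ s (∑ m ∈ R, f m) ∈ N) {m : ℝ} (hm : m ∈ R) :
    f m ∈ N := by
  refine mem_of_forall_sum_monoidHom_smul_mem N R f (fun m => imPowHom m.1 (hR m.1 m.2))
    (fun m n e => Subtype.ext (imPowHom_injective _ _ e)) (fun s => ?_) ⟨m, hm⟩
  have := hN s.toAdd
  rw [modConj, modConj_eq_sum hρ hu h] at this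
  rw [← Finset.sum_coe_sort] at this
  exact this

/-- A subspace invariant under conjugation by `ρ` is invariant under its modular group. -/
lemma modConj_mem_of_conj_mem {ρ : A} (hρ : 0 ≤ ρ) (hu : IsUnit ρ) {N : Submodule ℂ A}
    (hN : ∀ a ∈ N, ρ * a * opPow ρ (-1) ∈ N) {a : A} (ha : a ∈ N) (s : ℝ) :
    modConj ρ s a ∈ N := by
  obtain ⟨R, f, hR, rfl, hf⟩ := exists_modular_decomposition hρ hu a
  have hpow : ∀ k : ℕ, ∑ m ∈ R, (m : ℂ) ^ k • f m ∈ N := by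
    intro k
    induction k with
    | zero => simpa using ha
    | succ k ih =>
      have h1 := hN _ ih
      rw [Finset.mul_sum, Finset.sum_mul] at h1
      convert h1 using 1
      refine Finset.sum_congr rfl fun m hm => ?_
      have := hf m hm 1
      rw [opPow_one hρ, Complex.cpow_one] at this
      have h2 := opPow_mul_neg hρ hu 1
      rw [opPow_one hρ] at h2
      rw [mul_smul_comm, this, smul_mul_assoc, smul_mul_assoc, mul_assoc, h2, mul_one, smul_smul,
        pow_succ]
  -- The maps `k ↦ m ^ k` are distinct characters of `ℕ`, so integer iterates of conjugation already
  -- separate the eigencomponents.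
  have hmem : ∀ m ∈ R, f m ∈ N := by
    intro m hm
    refine mem_of_forall_sum_monoidHom_smul_mem (G := Multiplicative ℕ) N R f
      (fun m => powersHom ℂ (m.1 : ℂ))
      (fun m n e => Subtype.ext (by simpa using e)) (fun k => ?_) ⟨m, hm⟩
    have := hpow k.toAdd
    rw [← Finset.sum_coe_sort] at this
    exact this
  rw [modConj, modConj_eq_sum hρ hu hf]
  exact N.sum_mem fun m hm => N.smul_mem _ (hmem m hm)

/-! ### The multiplicative domain and the dual map -/

/-- The multiplicative domain of a linear map. -/
def multDomain (Φ : B →ₗ[ℂ] A) : Submodule ℂ B where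
  carrier := {m | (∀ x, Φ (x * m) = Φ x * Φ m) ∧ ∀ x, Φ (m * x) = Φ m * Φ x}
  add_mem' := by
    rintro a b ⟨ha, ha'⟩ ⟨hb, hb'⟩
    exact ⟨fun x => by rw [mul_add, map_add, map_add, mul_add, ha, hb],
      fun x => by rw [add_mul, map_add, map_add, add_mul, ha', hb']⟩
  zero_mem' := by simp
  smul_mem' c a := by
    rintro ⟨ha, ha'⟩
    exact ⟨fun x => by rw [mul_smul_comm, map_smul, map_smul, mul_smul_comm, ha],
      fun x => by rw [smul_mul_assoc, map_smul, map_smul, smul_mul_assoc, ha']⟩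

lemma IsUnitalSchwarz.mem_multDomain {Φ : B →ₗ[ℂ] A} (hΦ : IsUnitalSchwarz Φ) {q : B}
    (hq : star q = q) (hqq : Φ (q * q) = Φ q * Φ q) : q ∈ multDomain Φ := by
  have hs : star (Φ q) = Φ q := by rw [← hΦ.map_star, hq]
  exact ⟨hΦ.map_mul_right (by rw [hq, hs, hqq]), hΦ.map_mul_left (by rw [hq, hs, hqq])⟩

/-- Multiplicativity of `T*` at `m` dualises to `T(T*(m)ρ) = m T(ρ)` and `T(ρ T*(m)) = T(ρ)m`. So
`m` is an eigenvector of conjugation by `T ρ` with the same eigenvalue `r`, and the factors `r ^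
(1/2)` on the two sides match. -/
lemma dualMap_of_mem_multDomain {T : A →ₗ[ℂ] B} (hT : IsUnitalSchwarz (hsAdjoint T)) {ρ : A}
    (hρ : 0 ≤ ρ) (hu : IsUnit ρ) (hTu : IsUnit (T ρ)) {m : B}
    (hm : m ∈ multDomain (hsAdjoint T)) {r : ℝ} (hr : 0 < r)
    (h : ρ * hsAdjoint T m = (r : ℂ) • (hsAdjoint T m * ρ)) : dualMap T ρ (hsAdjoint T m) = m := by
  have hTρ := map_nonneg_of_hsAdjoint hT hρ
  have h1 : T (hsAdjoint T m * ρ) = m * T ρ := by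
    refine eq_of_subTr_mul_left fun x => ?_
    rw [← subTr_hsAdjoint_mul hT, ← mul_assoc, ← hm.1, subTr_hsAdjoint_mul hT, mul_assoc]
  have h2 : T (ρ * hsAdjoint T m) = T ρ * m := by
    refine eq_of_subTr_mul_left fun x => ?_
    rw [← subTr_hsAdjoint_mul hT, ← mul_assoc, subTr_mul_comm, ← mul_assoc, ← hm.2,
      subTr_hsAdjoint_mul hT, ← mul_assoc, subTr_mul_comm, ← mul_assoc, subTr_mul_cycle]
  have h3 : T ρ * m = (r : ℂ) • (m * T ρ) := by rw [← h2, h, map_smul, h1]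
  have h4 := opPow_mul_of_mul hρ hu hr h (1 / 2)
  have h5 := opPow_mul_of_mul hTρ hTu hr h3 (1 / 2)
  change opPow (T ρ) (-(1 / 2)) * T (opPow ρ (1 / 2) * hsAdjoint T m * opPow ρ (1 / 2)) *
    opPow (T ρ) (-(1 / 2)) = m
  rw [h4, smul_mul_assoc, mul_assoc (hsAdjoint T m), opPow_half_mul_half hρ hu, map_smul, h1,
    ← opPow_half_mul_half hTρ hTu, ← mul_assoc m, ← smul_mul_assoc, ← h5, ← mul_assoc, ← mul_assoc,
    opPow_half_mul_half hTρ hTu, opPow_neg_mul hTρ hTu, one_mul, mul_assoc,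
    opPow_mul_neg hTρ hTu, mul_one]

/-- Elements whose modular orbit is in the image of the multiplicative domain of `T*` are fixed
by `T* T_ρ`. -/
theorem hsAdjoint_dualMap_eq_self {T : A →ₗ[ℂ] B} (hT : IsUnitalSchwarz (hsAdjoint T)) {ρ : A}
    (hρ : 0 ≤ ρ) (hu : IsUnit ρ) (hTu : IsUnit (T ρ)) {a : A}
    (ha : ∀ s, modConj ρ s a ∈ (multDomain (hsAdjoint T)).map (hsAdjoint T)) :
    hsAdjoint T (dualMap T ρ a) = a := by
  obtain ⟨R, f, hR, rfl, hf⟩ := exists_modular_decomposition hρ hu a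
  rw [map_sum, map_sum]
  refine Finset.sum_congr rfl fun r hr => ?_
  obtain ⟨m, hm, hmf⟩ := mem_of_forall_modConj_mem hρ hu hR hf ha hr
  have h := hf r hr 1
  rw [opPow_one hρ, Complex.cpow_one, ← hmf] at h
  rw [← hmf, dualMap_of_mem_multDomain hT hρ hu hTu hm (hR r hr) h]

/-! ### Fixed points of a Schwarz map with a faithful invariant state -/

section FixedPoints

variable {Ψ L : A →ₗ[ℂ] A} (hΨ : IsUnitalSchwarz Ψ)
  (hdual : ∀ x a, subTr A (Ψ x * a) = subTr A (x * L a)) {ρ : A} (hρ : 0 ≤ ρ) (hu : IsUnit ρ)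
  (hLρ : L ρ = ρ)
include hΨ hdual hρ hu hLρ

/-- The Schwarz defect at a fixed point is positive and has zero expectation in the invariant state
`ρ`, which is faithful. -/
lemma map_star_mul_self_of_fixed {f : A} (hf : Ψ f = f) : Ψ (star f * f) = star f * f := by
  have h1 := hΨ.star_mul_le f
  rw [hf] at h1
  have h2 := mul_eq_zero_of_subTr_mul (sub_nonneg.2 h1) hρ (by
    rw [sub_mul, map_sub, hdual, hLρ, sub_self, Complex.zero_re])
  exact sub_eq_zero.1 ((hu.mul_left_eq_zero).1 h2)

lemma mem_multDomain_of_fixed {f : A} (hf : Ψ f = f) : f ∈ multDomain Ψ := by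
  have hf' : Ψ (star f) = star f := by rw [hΨ.map_star, hf]
  have h := map_star_mul_self_of_fixed hΨ hdual hρ hu hLρ hf'
  rw [star_star] at h
  exact ⟨hΨ.map_mul_right (by rw [map_star_mul_self_of_fixed hΨ hdual hρ hu hLρ hf, hf]),
    hΨ.map_mul_left (by rw [h, hf])⟩

lemma dual_fixed_mul {f : A} (hf : Ψ f = f) (a : A) : L (f * a) = f * L a := by
  refine eq_of_subTr_mul_left fun x => ?_
  have h := (mem_multDomain_of_fixed hΨ hdual hρ hu hLρ hf).1 x
  rw [hf] at h
  rw [← hdual, ← mul_assoc, ← h, hdual, mul_assoc]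

lemma dual_mul_fixed {f : A} (hf : Ψ f = f) (a : A) : L (a * f) = L a * f := by
  refine eq_of_subTr_mul_left fun x => ?_
  have h := (mem_multDomain_of_fixed hΨ hdual hρ hu hLρ hf).2 x
  rw [hf] at h
  rw [← hdual, ← mul_assoc, ← mul_assoc, subTr_mul_cycle, ← h, hdual, subTr_mul_cycle f,
    subTr_mul_cycle, subTr_mul_cycle]

omit hΨ hρ hu hLρ in
-- The trace pairing identifies `L - 1` with the transpose of `Ψ - 1`, so the ranks agree.
lemma finrank_fixed_eq : Module.finrank ℂ (LinearMap.ker (Ψ - 1)) =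
    Module.finrank ℂ (LinearMap.ker (L - 1)) := by
  have hcomm : (trEquiv A).toLinearMap ∘ₗ (L - 1) = (Ψ - 1).dualMap ∘ₗ (trEquiv A).toLinearMap := by
    ext a x
    change subTr A ((L a - a) * x) = subTr A (a * (Ψ x - x))
    rw [sub_mul, mul_sub, map_sub, map_sub, subTr_mul_comm, ← hdual, subTr_mul_comm a (Ψ x)]
  have h1 : Module.finrank ℂ (LinearMap.range (L - 1)) =
      Module.finrank ℂ (LinearMap.range (Ψ - 1)) := by
    rw [← LinearMap.finrank_range_dualMap_eq_finrank_range (Ψ - 1),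
      ← LinearMap.range_comp_of_range_eq_top (Ψ - 1).dualMap (trEquiv A).range, ← hcomm,
      LinearMap.range_comp]
    exact (LinearEquiv.finrank_map_eq (trEquiv A) _).symm
  have h2 := LinearMap.finrank_range_add_finrank_ker (Ψ - 1)
  have h3 := LinearMap.finrank_range_add_finrank_ker (L - 1)
  omega

/-- Multiplication by `ρ` embeds the fixed points of `Ψ` into those of `L`; equality of dimensions
makes it onto. -/
lemma exists_fixed_left {σ : A} (hσ : L σ = σ) : ∃ f, Ψ f = f ∧ σ = ρ * f := by
  have hle : (LinearMap.ker (Ψ - 1)).map (LinearMap.mulLeft ℂ ρ) ≤ LinearMap.ker (L - 1) := by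
    rintro _ ⟨f, hf, rfl⟩
    have hf' : Ψ f = f := sub_eq_zero.1 hf
    refine sub_eq_zero.2 ?_
    change L (ρ * f) = ρ * f
    rw [dual_mul_fixed hΨ hdual hρ hu hLρ hf', hLρ]
  have hinj : Function.Injective (LinearMap.mulLeft ℂ ρ) := hu.mul_right_injective
  have heq := Submodule.eq_of_le_of_finrank_eq hle (by
    rw [← finrank_fixed_eq hdual]
    exact (Submodule.equivMapOfInjective _ hinj _).finrank_eq.symm)
  have : σ ∈ LinearMap.ker (L - 1) := sub_eq_zero.2 hσ
  rw [← heq] at this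
  obtain ⟨f, hf, rfl⟩ := this
  exact ⟨f, sub_eq_zero.1 hf, rfl⟩

lemma exists_fixed_right {σ : A} (hσ : L σ = σ) : ∃ f, Ψ f = f ∧ σ = f * ρ := by
  have hle : (LinearMap.ker (Ψ - 1)).map (LinearMap.mulRight ℂ ρ) ≤ LinearMap.ker (L - 1) := by
    rintro _ ⟨f, hf, rfl⟩
    have hf' : Ψ f = f := sub_eq_zero.1 hf
    refine sub_eq_zero.2 ?_
    change L (f * ρ) = f * ρ
    rw [dual_fixed_mul hΨ hdual hρ hu hLρ hf', hLρ]
  have hinj : Function.Injective (LinearMap.mulRight ℂ ρ) := hu.mul_left_injective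
  have heq := Submodule.eq_of_le_of_finrank_eq hle (by
    rw [← finrank_fixed_eq hdual]
    exact (Submodule.equivMapOfInjective _ hinj _).finrank_eq.symm)
  have : σ ∈ LinearMap.ker (L - 1) := sub_eq_zero.2 hσ
  rw [← heq] at this
  obtain ⟨f, hf, rfl⟩ := this
  exact ⟨f, sub_eq_zero.1 hf, rfl⟩

/-- The fixed points of the predual map are invariant under the modular group. -/
theorem modConj_fixed {σ : A} (hσ : L σ = σ) (s : ℝ) : L (modConj ρ s σ) = modConj ρ s σ := by
  obtain ⟨f, hf, rfl⟩ := exists_fixed_left hΨ hdual hρ hu hLρ hσ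
  -- Both one-sided descriptions of the fixed points of `L` apply to `ρa`: writing it as `bρ` gives
  -- `ρaρ⁻¹ = b`, again fixed by `Ψ`.
  have hinv : ∀ a ∈ LinearMap.ker (Ψ - 1), ρ * a * opPow ρ (-1) ∈ LinearMap.ker (Ψ - 1) := by
    intro a ha
    have ha' : Ψ a = a := sub_eq_zero.1 ha
    obtain ⟨b, hb, hab⟩ := exists_fixed_right hΨ hdual hρ hu hLρ (σ := ρ * a)
      (by rw [dual_mul_fixed hΨ hdual hρ hu hLρ ha', hLρ])
    have h2 := opPow_mul_neg hρ hu 1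
    rw [opPow_one hρ] at h2
    rw [hab, mul_assoc, h2, mul_one]
    exact sub_eq_zero.2 hb
  have hfm : Ψ (modConj ρ s f) = modConj ρ s f :=
    sub_eq_zero.1 (modConj_mem_of_conj_mem hρ hu hinv (sub_eq_zero.2 hf) s)
  have hc : opPow ρ (Complex.I * s) * ρ = ρ * opPow ρ (Complex.I * s) := by
    have h1 := opPow_add hρ hu (Complex.I * s) 1
    have h2 := opPow_add hρ hu 1 (Complex.I * s)
    rw [opPow_one hρ] at h1 h2
    rw [← h1, ← h2, add_comm]
  have e : modConj ρ s (ρ * f) = ρ * modConj ρ s f := by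
    rw [modConj, modConj, ← mul_assoc, hc]
    simp only [mul_assoc]
  rw [e, dual_mul_fixed hΨ hdual hρ hu hLρ hfm, hLρ]

end FixedPoints

/-! ### The modular group acting on a pencil -/

lemma modConj_zero {ρ : A} (hρ : 0 ≤ ρ) (σ : A) : modConj ρ 0 σ = σ := by
  simp [modConj, opPow_zero hρ]

lemma modConj_eq_self_of_commute {ρ σ : A} (hρ : 0 ≤ ρ) (hu : IsUnit ρ) (h : σ * ρ = ρ * σ)
    (s : ℝ) : modConj ρ s σ = σ := by
  have hc : Commute (opPow ρ (Complex.I * s)) σ :=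
    Commute.cfc (h.symm : Commute ρ σ)
      (by rw [(IsSelfAdjoint.of_nonneg hρ).star_eq]; exact h.symm) _
  rw [modConj, hc.eq, mul_assoc, opPow_mul_neg hρ hu, mul_one]

lemma star_opPow_I_mul {ρ : A} (hρ : 0 ≤ ρ) (hu : IsUnit ρ) (s : ℝ) :
    star (opPow ρ (Complex.I * s)) = opPow ρ (-(Complex.I * s)) := by
  rw [star_opPow hρ hu]
  simp

lemma modConj_nonneg {ρ σ : A} (hρ : 0 ≤ ρ) (hu : IsUnit ρ) (hσ : 0 ≤ σ) (s : ℝ) :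
    0 ≤ modConj ρ s σ := by
  rw [modConj, ← star_opPow_I_mul hρ hu]
  exact star_right_conjugate_nonneg hσ _

lemma modConj_sub_smul {ρ σ : A} (hρ : 0 ≤ ρ) (hu : IsUnit ρ) (s : ℝ) (t : ℂ) :
    modConj ρ s (σ - t • ρ) = modConj ρ s σ - t • ρ := by
  have : modConj ρ s (σ - t • ρ) = modConj ρ s σ - t • modConj ρ s ρ := by
    simp [modConj, mul_sub, sub_mul]
  rw [this, modConj_eq_self_of_commute hρ hu rfl]

lemma modConj_mul {ρ : A} (hρ : 0 ≤ ρ) (hu : IsUnit ρ) (s : ℝ) (a b : A) :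
    modConj ρ s (a * b) = modConj ρ s a * modConj ρ s b := by
  have h := opPow_neg_mul hρ hu (Complex.I * s)
  calc modConj ρ s (a * b) = opPow ρ (Complex.I * s) * a * 1 * b * opPow ρ (-(Complex.I * s)) := by
        simp [modConj, mul_assoc]
    _ = _ := by rw [← h]; simp only [modConj, mul_assoc]

lemma star_modConj {ρ : A} (hρ : 0 ≤ ρ) (hu : IsUnit ρ) (s : ℝ) (a : A) :
    star (modConj ρ s a) = modConj ρ s (star a) := by
  rw [modConj, modConj, star_mul, star_mul, star_opPow_I_mul hρ hu, ← star_opPow_I_mul hρ hu,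
    star_star, mul_assoc]

lemma modConj_modConj_neg {ρ : A} (hρ : 0 ≤ ρ) (hu : IsUnit ρ) (s : ℝ) (a : A) :
    modConj ρ s (modConj ρ (-s) a) = a := by
  have h := opPow_mul_neg hρ hu (Complex.I * s)
  have e : modConj ρ s (modConj ρ (-s) a) = (opPow ρ (Complex.I * s) * opPow ρ (-(Complex.I * s))) *
      a * (opPow ρ (Complex.I * s) * opPow ρ (-(Complex.I * s))) := by
    simp [modConj, mul_assoc]
  rw [e, h, one_mul, mul_one]

/-- Conjugation by `ρ^{is}` is a star automorphism, so kernel projections move with their operators.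
-/
lemma IsKerProj.modConj {ρ X p : A} (hρ : 0 ≤ ρ) (hu : IsUnit ρ) (hp : IsKerProj X p) (s : ℝ) :
    IsKerProj (modConj ρ s X) (modConj ρ s p) where
  isSelfAdjoint := by rw [star_modConj hρ hu, hp.isSelfAdjoint]
  idem := by rw [← modConj_mul hρ hu, hp.idem]
  mul_eq_zero := by rw [← modConj_mul hρ hu, hp.mul_eq_zero]; simp [QRev.modConj]
  mul_eq_self c hc := by
    obtain ⟨d, rfl⟩ : ∃ d, c = QRev.modConj ρ s d := ⟨_, (modConj_modConj_neg hρ hu s c).symm⟩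
    rw [← modConj_mul hρ hu] at hc ⊢
    have h0 : X * d = 0 := by
      have := congrArg (QRev.modConj ρ (-s)) hc
      have h2 := modConj_modConj_neg hρ hu (-s) (X * d)
      rw [neg_neg] at h2
      rw [h2] at this
      simpa [QRev.modConj] using this
    rw [hp.mul_eq_self d h0]

lemma isSelfAdjoint_sub_smul {ρ σ : A} (hρ : 0 ≤ ρ) (hσ : 0 ≤ σ) (t : ℝ) :
    IsSelfAdjoint (σ - (t : ℂ) • ρ) := by
  rw [IsSelfAdjoint, star_sub, star_smul, (IsSelfAdjoint.of_nonneg hσ).star_eq,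
    (IsSelfAdjoint.of_nonneg hρ).star_eq]
  simp

/-! ### Spectral decomposition of the pencil -/

lemma mul_specProj {M : A} (hM : IsSelfAdjoint M) (l : ℂ) :
    M * specProj M l = l • specProj M l := by
  have : IsStarNormal M := hM.isStarNormal
  have h : M * specProj M l = cfc (fun w : ℂ => w) M * specProj M l := by rw [cfc_id' ℂ M]
  rw [h, specProj, ← cfc_mul _ _ M (continuousOn_spectrum_complex _ _)
    (continuousOn_spectrum_complex _ _), ← cfc_const_mul _ _ M (continuousOn_spectrum_complex _ _)]
  exact cfc_congr fun x _ => by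
    by_cases hx : x = l <;> simp [hx]

/-- The kernels of the operators `σ - tρ` span the whole space. -/
lemma eq_zero_of_pencil {ρ σ D : A} (hρ : 0 ≤ ρ) (hu : IsUnit ρ) (hσ : 0 ≤ σ)
    (h : ∀ (t : ℝ) (c : A), (σ - (t : ℂ) • ρ) * c = 0 → D * c = 0) : D = 0 := by
  have h12 : star (-(1 / 2) : ℂ) = -(1 / 2) := by simp
  set M := opPow ρ (-(1 / 2)) * σ * opPow ρ (-(1 / 2)) with hMdef
  have hM : IsSelfAdjoint M := by
    rw [IsSelfAdjoint, hMdef, star_mul, star_mul, star_opPow hρ hu, h12,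
      (IsSelfAdjoint.of_nonneg hσ).star_eq, mul_assoc]
  -- If `Mv = lv`, then `ρ^{-1/2}v` lies in the kernel of `σ - lρ`; `l` is real as `M` is
  -- selfadjoint.
  have hz : ∀ l ∈ (finite_spectrum_complex M).toFinset,
      D * opPow ρ (-(1 / 2)) * specProj M l = 0 := by
    intro l hl
    have hre := hM.mem_spectrum_eq_re (by simpa using hl)
    rw [mul_assoc]
    refine h l.re _ ?_
    have e1 : σ * opPow ρ (-(1 / 2)) = opPow ρ (1 / 2) * M := by
      rw [hMdef, ← mul_assoc, ← mul_assoc, opPow_mul_neg hρ hu, one_mul]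
    have e2 : ρ * opPow ρ (-(1 / 2)) = opPow ρ (1 / 2) := by
      nth_rewrite 1 [← opPow_half_mul_half hρ hu]
      rw [mul_assoc, opPow_mul_neg hρ hu, mul_one]
    rw [← hre, sub_mul, ← mul_assoc, e1, mul_assoc, mul_specProj hM, smul_mul_assoc, ← mul_assoc,
      e2, mul_smul_comm, sub_self]
  have h1 : D * opPow ρ (-(1 / 2)) = 0 := by
    rw [← mul_one (D * opPow ρ (-(1 / 2))), ← sum_specProj hM, Finset.mul_sum]
    exact Finset.sum_eq_zero hz
  rw [← mul_one D, ← opPow_neg_mul hρ hu (1 / 2), ← mul_assoc, h1, zero_mul]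

/-! ### Reversibility -/

lemma IsState.nonneg {σ : A} (h : IsState σ) : 0 ≤ σ := h.1

/-- Preservation of the trace norms of `σ - tρ` gives `T*` of the kernel projections. -/
lemma hsAdjoint_kerProj_pencil {T : A →ₗ[ℂ] B} (hT : IsUnitalSchwarz (hsAdjoint T)) {ρ σ : A}
    (hρ : 0 ≤ ρ) (hu : IsUnit ρ) (hσ : 0 ≤ σ)
    (h : ∀ t : ℝ, 0 ≤ t → traceNorm ((σ - (t : ℂ) • ρ : A) : H →L[ℂ] H) =
      traceNorm ((T σ - (t : ℂ) • T ρ : B) : K →L[ℂ] K)) (t : ℝ) :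
    hsAdjoint T (kerProj (T (σ - (t : ℂ) • ρ))) = kerProj (σ - (t : ℂ) • ρ) := by
  refine hsAdjoint_kerProj hT (isSelfAdjoint_sub_smul hρ hσ t) hρ hu fun e => ?_
  have e1 : σ - (t : ℂ) • ρ + (e : ℂ) • ρ = σ - ((t - e : ℝ) : ℂ) • ρ := by
    push_cast
    rw [sub_smul]
    abel
  rw [e1]
  -- For a negative parameter the operator is positive, so both trace norms are traces, which `T`
  -- preserves. Thus the whole real line is covered.
  rcases le_or_gt 0 (t - e) with h0 | h0
  · rw [h _ h0, map_sub, map_smul]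
  · have hpos : 0 ≤ σ - ((t - e : ℝ) : ℂ) • ρ := by
      rw [sub_eq_add_neg, ← neg_smul, ← Complex.ofReal_neg, Complex.coe_smul]
      exact add_nonneg hσ (smul_nonneg (by linarith) hρ)
    rw [traceNorm_of_nonneg hpos, traceNorm_of_nonneg (map_nonneg_of_hsAdjoint hT hpos),
      subTr_map hT]

/-- A projection sent by `T*` to a projection gives equality in the Schwarz inequality. -/
lemma kerProj_mem_map_multDomain {T : A →ₗ[ℂ] B} (hT : IsUnitalSchwarz (hsAdjoint T)) {X : A}
    (hX : IsSelfAdjoint X) (h : hsAdjoint T (kerProj (T X)) = kerProj X) :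
    kerProj X ∈ (multDomain (hsAdjoint T)).map (hsAdjoint T) := by
  have hTX : IsSelfAdjoint (T X) := by
    rw [IsSelfAdjoint, ← map_star_of_hsAdjoint hT, hX.star_eq]
  refine ⟨kerProj (T X), hT.mem_multDomain (isKerProj_kerProj hTX).isSelfAdjoint ?_, h⟩
  rw [(isKerProj_kerProj hTX).idem, h, (isKerProj_kerProj hX).idem]

lemma subTr_mul_predual {R : B →ₗ[ℂ] A} (hR : IsUnitalSchwarz (hsAdjoint R)) (T : A →ₗ[ℂ] B)
    (hT : IsUnitalSchwarz (hsAdjoint T)) (x a : A) :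
    subTr A ((hsAdjoint T ∘ₗ hsAdjoint R) x * a) = subTr A (x * (R ∘ₗ T) a) := by
  rw [LinearMap.comp_apply, subTr_hsAdjoint_mul hT, subTr_hsAdjoint_mul hR, LinearMap.comp_apply]

section

variable {T : A →ₗ[ℂ] B} (hT : IsUnitalSchwarz (hsAdjoint T)) {ρ : A} (hρ : 0 ≤ ρ) (hu : IsUnit ρ)
include hT hρ hu

/-- The dual of `T_ρ` recovers `ρ`. -/
lemma hsAdjoint_dualMap_apply (hTu : IsUnit (T ρ))
    (hTdual : IsUnitalSchwarz (dualMap T ρ)) : hsAdjoint (dualMap T ρ) (T ρ) = ρ := by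
  have hR : IsUnitalSchwarz (hsAdjoint (hsAdjoint (dualMap T ρ))) := by
    rwa [hsAdjoint_hsAdjoint]
  have hTρ := map_nonneg_of_hsAdjoint hT hρ
  refine eq_of_subTr_mul_left fun x => ?_
  rw [← subTr_hsAdjoint_mul hR, hsAdjoint_hsAdjoint]
  change subTr B (opPow (T ρ) (-(1 / 2)) * T (opPow ρ (1 / 2) * x * opPow ρ (1 / 2)) *
    opPow (T ρ) (-(1 / 2)) * T ρ) = _
  have e1 : opPow (T ρ) (-(1 / 2)) * T ρ = opPow (T ρ) (1 / 2) := by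
    nth_rewrite 2 [← opPow_half_mul_half hTρ hTu]
    rw [← mul_assoc, opPow_neg_mul hTρ hTu, one_mul]
  rw [mul_assoc, e1, subTr_mul_cycle, opPow_mul_neg hTρ hTu, one_mul, subTr_map hT,
    subTr_mul_cycle, opPow_half_mul_half hρ hu, subTr_mul_comm]

/-- Preservation of trace norms along the modular orbit of `σ` implies recovery of `σ`. -/
theorem hsAdjoint_dualMap_apply_of_traceNorm (hTu : IsUnit (T ρ))
    (hTdual : IsUnitalSchwarz (dualMap T ρ)) {σ : A} (hσ : 0 ≤ σ)
    (h : ∀ s t : ℝ, 0 ≤ t → traceNorm ((modConj ρ s σ - (t : ℂ) • ρ : A) : H →L[ℂ] H) =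
      traceNorm ((T (modConj ρ s σ) - (t : ℂ) • T ρ : B) : K →L[ℂ] K)) :
    hsAdjoint (dualMap T ρ) (T σ) = σ := by
  set R := hsAdjoint (dualMap T ρ) with hRdef
  have hRadj : hsAdjoint R = dualMap T ρ := hsAdjoint_hsAdjoint _
  have hR : IsUnitalSchwarz (hsAdjoint R) := by rwa [hRadj]
  have hΨ := hR.comp hT
  have hdual := subTr_mul_predual hR T hT
  have hRρ : (R ∘ₗ T) ρ = ρ := hsAdjoint_dualMap_apply hT hρ hu hTu hTdual
  rw [← sub_eq_zero]
  refine eq_zero_of_pencil hρ hu hσ fun t c hc => ?_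
  have hk := isKerProj_kerProj (isSelfAdjoint_sub_smul hρ hσ t)
  set k := kerProj (σ - (t : ℂ) • ρ) with hkdef
  have hkfix : (hsAdjoint T ∘ₗ hsAdjoint R) k = k := by
    rw [hRadj]
    refine hsAdjoint_dualMap_eq_self hT hρ hu hTu fun s => ?_
    -- The modular group fixes `ρ`, so it carries `k` to the kernel projection of another pencil in
    -- the orbit, where the norm hypothesis applies.
    have hσs := modConj_nonneg hρ hu hσ s
    have e := hk.modConj hρ hu s
    rw [modConj_sub_smul hρ hu] at e
    rw [e.unique (isKerProj_kerProj (isSelfAdjoint_sub_smul hρ hσs t))]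
    exact kerProj_mem_map_multDomain hT (isSelfAdjoint_sub_smul hρ hσs t)
      (hsAdjoint_kerProj_pencil hT hρ hu hσs (h s) t)
  have hσk : σ * k = (t : ℂ) • (ρ * k) := by
    have := hk.mul_eq_zero
    rwa [sub_mul, smul_mul_assoc, sub_eq_zero] at this
  -- With `L = R T`: `L(σ)k = L(σk) = tL(ρk) = tρk = σk`.
  have h1 : (R ∘ₗ T) (σ * k) = (R ∘ₗ T) σ * k := dual_mul_fixed hΨ hdual hρ hu hRρ hkfix σ
  have h2 : (R ∘ₗ T) (ρ * k) = (R ∘ₗ T) ρ * k := dual_mul_fixed hΨ hdual hρ hu hRρ hkfix ρ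
  rw [hσk, map_smul, h2, hRρ, ← hσk] at h1
  rw [← hk.mul_eq_self c hc, ← mul_assoc, sub_mul, h1]
  simp

/-- Reversibility for `S` implies preservation of trace norms on the extended family. -/
lemma IsReversible.preservesTraceNorm {S : Set A} (hS : ∀ σ ∈ S, 0 ≤ σ) (hρS : ρ ∈ S)
    (h : IsReversible T S) : PreservesTraceNorm T ρ (extFamily ρ S) := by
  obtain ⟨R, hR, hRS⟩ := h
  have hΨ := hR.comp hT
  have hdual := subTr_mul_predual hR T hT
  intro τ hτ t _
  obtain ⟨s, σ, hσ, rfl⟩ := Set.mem_iUnion.1 hτ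
  have hfix : R (T (modConj ρ s σ)) = modConj ρ s σ :=
    modConj_fixed hΨ hdual hρ hu (hRS ρ hρS) (hRS σ hσ) s
  have hX := isSelfAdjoint_sub_smul hρ (modConj_nonneg hρ hu (hS σ hσ) s) t
  rw [← map_smul, ← map_sub]
  refine le_antisymm ?_ (traceNorm_map_le hT hX)
  have hTX : IsSelfAdjoint (T (modConj ρ s σ - (t : ℂ) • ρ)) := by
    rw [IsSelfAdjoint, ← map_star_of_hsAdjoint hT, hX.star_eq]
  have := traceNorm_map_le hR hTX
  rwa [map_sub, map_smul, map_sub, map_smul, hfix, hRS ρ hρS, ← map_smul, ← map_sub] at this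

lemma isReversible_of_preservesTraceNorm {S : Set A} (hS : ∀ σ ∈ S, 0 ≤ σ)
    (hTu : IsUnit (T ρ)) (hTdual : IsUnitalSchwarz (dualMap T ρ))
    (h : PreservesTraceNorm T ρ (extFamily ρ S)) : IsReversible T S := by
  refine ⟨hsAdjoint (dualMap T ρ), by rwa [hsAdjoint_hsAdjoint], fun σ hσ => ?_⟩
  exact hsAdjoint_dualMap_apply_of_traceNorm hT hρ hu hTu hTdual (hS σ hσ) fun s t ht =>
    h _ (Set.mem_iUnion.2 ⟨s, σ, hσ, rfl⟩) t ht

end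

/-! ### Commuting kernel projections -/

section Commuting

variable {ρ σ τ : A} (hρ : 0 ≤ ρ) (hu : IsUnit ρ) (hσ : 0 ≤ σ) (hτ : 0 ≤ τ)
include hρ hu hσ

lemma mul_kerProj_pencil (t : ℝ) : σ * kerProj (σ - (t : ℂ) • ρ) =
    (t : ℂ) • (ρ * kerProj (σ - (t : ℂ) • ρ)) := by
  have := (isKerProj_kerProj (isSelfAdjoint_sub_smul hρ hσ t)).mul_eq_zero
  rwa [sub_mul, smul_mul_assoc, sub_eq_zero] at this

lemma kerProj_pencil_mul (t : ℝ) : kerProj (σ - (t : ℂ) • ρ) * σ =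
    (t : ℂ) • (kerProj (σ - (t : ℂ) • ρ) * ρ) := by
  have h := congrArg star (mul_kerProj_pencil hρ hu hσ t)
  rw [star_mul, star_smul, star_mul, (IsSelfAdjoint.of_nonneg hσ).star_eq,
    (IsSelfAdjoint.of_nonneg hρ).star_eq,
    (isKerProj_kerProj (isSelfAdjoint_sub_smul hρ hσ t)).isSelfAdjoint] at h
  simpa using h

lemma eq_of_mul_kerProj_pencil {x y : A}
    (h : ∀ t : ℝ, x * kerProj (σ - (t : ℂ) • ρ) = y * kerProj (σ - (t : ℂ) • ρ)) : x = y := by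
  rw [← sub_eq_zero]
  refine eq_zero_of_pencil hρ hu hσ fun t c hc => ?_
  rw [← (isKerProj_kerProj (isSelfAdjoint_sub_smul hρ hσ t)).mul_eq_self c hc, ← mul_assoc,
    sub_mul, h, sub_self, zero_mul]

/-- For `s ≠ t`, moving `σ` onto either projection yields both factors `s` and `t`, so `k s * k t`
and `k s * ρ * k t` vanish. Hence `k t * ρ` and `k t * ρ * k t` agree on the spanning kernels;
taking adjoints gives commutation. -/
lemma commute_kerProj_pencil
    (hc : ∀ s t : ℝ, kerProj (σ - (s : ℂ) • ρ) * kerProj (σ - (t : ℂ) • ρ) =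
      kerProj (σ - (t : ℂ) • ρ) * kerProj (σ - (s : ℂ) • ρ)) (t : ℝ) :
    ρ * kerProj (σ - (t : ℂ) • ρ) = kerProj (σ - (t : ℂ) • ρ) * ρ := by
  set k : ℝ → A := fun t => kerProj (σ - (t : ℂ) • ρ) with hk
  have hσk : ∀ t, σ * k t = (t : ℂ) • (ρ * k t) := mul_kerProj_pencil hρ hu hσ
  have hkσ : ∀ t, k t * σ = (t : ℂ) • (k t * ρ) := kerProj_pencil_mul hρ hu hσ
  have hp : ∀ t : ℝ, IsKerProj (σ - (t : ℂ) • ρ) (k t) := fun t =>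
    isKerProj_kerProj (isSelfAdjoint_sub_smul hρ hσ t)
  have horth : ∀ s t : ℝ, s ≠ t → k s * k t = 0 := by
    intro s t hst
    have h1 : σ * (k s * k t) = (s : ℂ) • (ρ * (k s * k t)) := by
      rw [← mul_assoc, hσk, smul_mul_assoc, mul_assoc]
    have h2 : σ * (k s * k t) = (t : ℂ) • (ρ * (k s * k t)) := by
      rw [hc s t, ← mul_assoc, hσk, smul_mul_assoc, mul_assoc]
    rw [h1, ← sub_eq_zero, ← sub_smul] at h2
    exact (hu.mul_right_eq_zero).1 ((smul_eq_zero.1 h2).resolve_left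
      (sub_ne_zero.2 (by exact_mod_cast hst)))
  have hoff : ∀ s t : ℝ, s ≠ t → k s * ρ * k t = 0 := by
    intro s t hst
    have h1 : k s * σ * k t = (s : ℂ) • (k s * ρ * k t) := by rw [hkσ, smul_mul_assoc]
    have h2 : k s * σ * k t = (t : ℂ) • (k s * ρ * k t) := by
      rw [mul_assoc, hσk, mul_smul_comm, mul_assoc]
    rw [h1, ← sub_eq_zero, ← sub_smul] at h2
    exact (smul_eq_zero.1 h2).resolve_left (sub_ne_zero.2 (by exact_mod_cast hst))
  have h1 : k t * ρ = k t * ρ * k t := by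
    refine eq_of_mul_kerProj_pencil hρ hu hσ fun s => ?_
    change k t * ρ * k s = k t * ρ * k t * k s
    by_cases hst : s = t
    · rw [hst, mul_assoc (k t * ρ), (hp t).idem]
    · rw [hoff t s (Ne.symm hst), mul_assoc (k t * ρ), horth t s (Ne.symm hst), mul_zero]
  have h2 := congrArg star h1
  rw [star_mul, star_mul, star_mul, (hp t).isSelfAdjoint, (IsSelfAdjoint.of_nonneg hρ).star_eq,
    ← mul_assoc, ← h1] at h2
  exact h2

lemma commute_of_commute_kerProj
    (hc : ∀ s t : ℝ, kerProj (σ - (s : ℂ) • ρ) * kerProj (σ - (t : ℂ) • ρ) =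
      kerProj (σ - (t : ℂ) • ρ) * kerProj (σ - (s : ℂ) • ρ)) : σ * ρ = ρ * σ := by
  refine eq_of_mul_kerProj_pencil hρ hu hσ fun t => ?_
  have h1 := commute_kerProj_pencil hρ hu hσ hc t
  rw [mul_assoc, h1, ← mul_assoc, mul_kerProj_pencil hρ hu hσ, mul_assoc,
    mul_kerProj_pencil hρ hu hσ, smul_mul_assoc, mul_smul_comm, h1, mul_assoc, ← h1,
    ← mul_assoc, ← h1, mul_assoc, ← h1]

include hτ in
-- On each kernel of a pencil, `σ` or `τ` acts as a multiple of `ρ`. So `τ` first inherits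
-- commutation with the projections of `σ`, and then with `σ`.
lemma commute_of_commute_kerProj_pair
    (hσσ : ∀ s t : ℝ, kerProj (σ - (s : ℂ) • ρ) * kerProj (σ - (t : ℂ) • ρ) =
      kerProj (σ - (t : ℂ) • ρ) * kerProj (σ - (s : ℂ) • ρ))
    (hττ : ∀ s t : ℝ, kerProj (τ - (s : ℂ) • ρ) * kerProj (τ - (t : ℂ) • ρ) =
      kerProj (τ - (t : ℂ) • ρ) * kerProj (τ - (s : ℂ) • ρ))
    (hστ : ∀ s t : ℝ, kerProj (σ - (s : ℂ) • ρ) * kerProj (τ - (t : ℂ) • ρ) =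
      kerProj (τ - (t : ℂ) • ρ) * kerProj (σ - (s : ℂ) • ρ)) : σ * τ = τ * σ := by
  have hτρ := commute_of_commute_kerProj hρ hu hτ hττ
  have hkτ : ∀ t : ℝ, τ * kerProj (σ - (t : ℂ) • ρ) = kerProj (σ - (t : ℂ) • ρ) * τ := by
    intro t
    refine eq_of_mul_kerProj_pencil hρ hu hτ fun s => ?_
    rw [mul_assoc, hστ, ← mul_assoc, mul_kerProj_pencil hρ hu hτ, mul_assoc,
      mul_kerProj_pencil hρ hu hτ, smul_mul_assoc, mul_smul_comm, mul_assoc, ← hστ, ← mul_assoc,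
      commute_kerProj_pencil hρ hu hσ hσσ, mul_assoc]
  refine eq_of_mul_kerProj_pencil hρ hu hσ fun t => ?_
  rw [mul_assoc, hkτ, ← mul_assoc, mul_kerProj_pencil hρ hu hσ, mul_assoc,
    mul_kerProj_pencil hρ hu hσ, smul_mul_assoc, mul_smul_comm, mul_assoc, ← hkτ, ← mul_assoc,
    ← mul_assoc, hτρ]

end Commuting

/-- `Φ(m)Φ(n) = Φ(mn) = Φ(nm) = Φ(n)Φ(m)` on the multiplicative domain. -/
lemma commute_of_mem_map_multDomain {Φ : B →ₗ[ℂ] A} (hB : ∀ x y : B, x * y = y * x) {a b : A}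
    (ha : a ∈ (multDomain Φ).map Φ) (hb : b ∈ (multDomain Φ).map Φ) : a * b = b * a := by
  obtain ⟨m, hm, rfl⟩ := ha
  obtain ⟨n, hn, rfl⟩ := hb
  rw [← hm.2, ← hn.2, hB]

lemma subset_extFamily {ρ : A} (hρ : 0 ≤ ρ) (S : Set A) : S ⊆ extFamily ρ S := fun σ hσ =>
  Set.mem_iUnion.2 ⟨0, σ, hσ, modConj_zero hρ σ⟩

lemma PreservesTraceNorm.mono {T : A →ₗ[ℂ] B} {ρ : A} {S S' : Set A} (hS : S ⊆ S')
    (h : PreservesTraceNorm T ρ S') : PreservesTraceNorm T ρ S := fun σ hσ => h σ (hS hσ)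

lemma modConj_image_subset_of_commute {ρ : A} (hρ : 0 ≤ ρ) (hu : IsUnit ρ) {S : Set A}
    (h : ∀ σ ∈ S, σ * ρ = ρ * σ) (s : ℝ) : modConj ρ s '' S ⊆ S := by
  rintro _ ⟨σ, hσ, rfl⟩
  rwa [modConj_eq_self_of_commute hρ hu (h σ hσ)]

/-- If `B` is abelian, preservation of the trace norms forces commutativity. -/
lemma commute_of_preservesTraceNorm {T : A →ₗ[ℂ] B} (hT : IsUnitalSchwarz (hsAdjoint T)) {ρ : A}
    (hρ : 0 ≤ ρ) (hu : IsUnit ρ) (hB : ∀ x y : B, x * y = y * x) {S : Set A}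
    (hS : ∀ σ ∈ S, 0 ≤ σ) (h : PreservesTraceNorm T ρ S) :
    ∀ σ ∈ S, ∀ τ ∈ S, σ * τ = τ * σ := by
  have hmem : ∀ σ ∈ S, ∀ t : ℝ, kerProj (σ - (t : ℂ) • ρ) ∈
      (multDomain (hsAdjoint T)).map (hsAdjoint T) := fun σ hσ t =>
    kerProj_mem_map_multDomain hT (isSelfAdjoint_sub_smul hρ (hS σ hσ) t)
      (hsAdjoint_kerProj_pencil hT hρ hu (hS σ hσ) (h σ hσ) t)
  intro σ hσ τ hτ
  exact commute_of_commute_kerProj_pair hρ hu (hS σ hσ) (hS τ hτ)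
    (fun s t => commute_of_mem_map_multDomain hB (hmem σ hσ s) (hmem σ hσ t))
    (fun s t => commute_of_mem_map_multDomain hB (hmem τ hτ s) (hmem τ hτ t))
    (fun s t => commute_of_mem_map_multDomain hB (hmem σ hσ s) (hmem τ hτ t))

end QRev

end

/-! ### The equivalences -/

theorem theorem5 {H K : Type*}
    [NormedAddCommGroup H] [InnerProductSpace ℂ H] [CompleteSpace H] [FiniteDimensional ℂ H]
    [NormedAddCommGroup K] [InnerProductSpace ℂ K] [CompleteSpace K] [FiniteDimensional ℂ K]
    (A : StarSubalgebra ℂ (H →L[ℂ] H)) (B : StarSubalgebra ℂ (K →L[ℂ] K))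
    (T : A →ₗ[ℂ] B) (S : Set A) (hS : ∀ σ ∈ S, QRev.IsState σ)
    (ρ : A) (hρS : ρ ∈ S) (hρ : IsUnit ρ) (hTρ : IsUnit (T ρ))
    (hT : QRev.IsUnitalSchwarz (QRev.hsAdjoint T))
    (hTdual : QRev.IsUnitalSchwarz (QRev.dualMap T ρ)) :
    (QRev.IsReversible T S ↔ QRev.PreservesTraceNorm T ρ (QRev.extFamily ρ S)) ∧
    ((∀ s : ℝ, QRev.modConj ρ s '' S ⊆ S) →
      (QRev.IsReversible T S ↔ QRev.PreservesTraceNorm T ρ S)) ∧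
    ((∀ x y : B, x * y = y * x) →
      (QRev.IsReversible T S ↔ QRev.PreservesTraceNorm T ρ S) ∧
      (QRev.IsReversible T S → ∀ σ ∈ S, ∀ τ ∈ S, σ * τ = τ * σ)) ∧
    ((∀ σ ∈ S, σ * ρ = ρ * σ) →
      (QRev.IsReversible T S ↔ QRev.PreservesTraceNorm T ρ S)) := by
  have hpos : ∀ σ ∈ S, 0 ≤ σ := fun σ hσ => (hS σ hσ).nonneg
  have hρ0 := hpos ρ hρS
  have h1 : QRev.IsReversible T S ↔ QRev.PreservesTraceNorm T ρ (QRev.extFamily ρ S) :=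
    ⟨QRev.IsReversible.preservesTraceNorm hT hρ0 hρ hpos hρS,
      QRev.isReversible_of_preservesTraceNorm hT hρ0 hρ hpos hTρ hTdual⟩
  have h2 : QRev.IsReversible T S → QRev.PreservesTraceNorm T ρ S := fun h =>
    (h1.1 h).mono (QRev.subset_extFamily hρ0 S)
  have h3 : (∀ s : ℝ, QRev.modConj ρ s '' S ⊆ S) →
      (QRev.IsReversible T S ↔ QRev.PreservesTraceNorm T ρ S) := fun hinv =>
    ⟨h2, fun h => h1.2 (h.mono (Set.iUnion_subset hinv))⟩
  refine ⟨h1, h3, fun hB => ?_, fun hc =>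
    h3 (QRev.modConj_image_subset_of_commute hρ0 hρ hc)⟩
  have hcomm := QRev.commute_of_preservesTraceNorm hT hρ0 hρ hB hpos
  -- Since `ρ` itself belongs to `S`, commutativity of `S` makes the modular action on it trivial,
  -- so the invariant case applies.
  exact ⟨⟨h2, fun h => (h3 (QRev.modConj_image_subset_of_commute hρ0 hρ fun σ hσ =>
    hcomm h σ hσ ρ hρS)).2 h⟩, fun h => hcomm (h2 h)⟩
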